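/- Let $\Omega\subset\mathbb C$ be a Borel set, $\lambda$ Lebesgue measure, and let $\mathcal B(L^2(\Omega,\lambda))$ be the algebra of bounded operators on $L^2(\Omega,\lambda)$. Write $|A|_2=(\operatorname{Tr}A^*A)^{1/2}\in[0,\infty]$ for the Hilbert--Schmidt norm and $M_f$ for multiplication by $f\in L^\infty(\Omega,\lambda)$ on $L^2(\Omega,\lambda)$. Put $Df(s,t)=\frac{f(s)-f(t)}{s-t}$ for $s\neq t$, let $\Lambda(\Omega)$ be the set of all $f\in L^\infty(\Omega,\lambda)$ with $Df\in L^\infty(\Omega\times\Omega,\lambda\otimes\lambda)$, and for $T\in\mathcal B(L^2(\Omega,\lambda))$ let $$L(T)=\sup\{|[M_f,T]|_2 : f\in\Lambda(\Omega),\ \|Df\|_\infty\le 1\}\in[0,\infty].$$ Let $E\Lambda(\Omega)$ be the subalgebra $\{T\in\mathcal B(L^2(\Omega,\lambda)) : L(T)<\infty\}$, with the norm $|||T|||=\|T\|+L(T)$. For $w\in\mathbb C$ let $U(w)$ be multiplication by the function $z\mapsto\exp(i\operatorname{Re}(z\overline w))$ on $L^2(\Omega,\lambda)$, and let $$L_1(T)=\sup\{|w|^{-1}\,|[T,U(w)]|_2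 : w\in\mathbb C\setminus\{0\}\}\in[0,\infty].$$ (1) For every $T\in\mathcal B(L^2(\Omega,\lambda))$ we have $L_1(T)\le L(T)\le 2L_1(T)$. (2) $|||T|||_1=\|T\|+L_1(T)$ is a Banach algebra norm on $E\Lambda(\Omega)$ (a submultiplicative norm of complex vector spaces for which $E\Lambda(\Omega)$ is complete), and it is equivalent to the norm $|||\cdot|||$. (3) If $\Omega$ is bounded and $Z$ denotes multiplication by the coordinate function $z$ on $L^2(\Omega,\lambda)$, then $L(T)=|[T,Z]|_2$ for every $T\in\mathcal B(L^2(\Omega,\lambda))$ (both sides may be $+\infty$). -/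

import Mathlib

open MeasureTheory
open scoped ENNReal ComplexConjugate

namespace ELam

noncomputable section

/-! ### The Hilbert–Schmidt norm -/

section HilbertSchmidt

variable {H : Type*} [NormedAddCommGroup H] [InnerProductSpace ℂ H]

theorem parseval {ι : Type*} (b : HilbertBasis ι ℂ H) (x : H) :
    ∑' i, ‖inner ℂ (b i) x‖ₑ ^ 2 = ‖x‖ₑ ^ 2 := by
  have h := (b.hasSum_inner_mul_inner x x).mapL Complex.reCLM
  have h2 : HasSum (fun i => ‖inner ℂ (b i) x‖ ^ 2) (‖x‖ ^ 2) := by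
    convert! h using 1
    · funext i
      have : (inner ℂ x (b i) : ℂ) = conj (inner ℂ (b i) x : ℂ) := (inner_conj_symm _ _).symm
      rw [this, mul_comm, Complex.mul_conj, Complex.normSq_eq_norm_sq]
      simp only [Complex.reCLM_apply, Complex.ofReal_re]
    · rw [inner_self_eq_norm_sq_to_K]
      norm_cast
  have h3 := ENNReal.ofReal_tsum_of_nonneg (f := fun i => ‖inner ℂ (b i) x‖ ^ 2)
    (fun i => by positivity) h2.summable
  rw [h2.tsum_eq] at h3
  simp only [ENNReal.ofReal_pow (norm_nonneg _), ofReal_norm] at h3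
  exact h3.symm

variable [CompleteSpace H]

variable (H) in
/-- The index set of a chosen orthonormal basis of a complex Hilbert space. -/
def basisIndex : Set H := (exists_hilbertBasis ℂ H).choose

variable (H) in
/-- A chosen orthonormal basis of a complex Hilbert space. -/
def basis : HilbertBasis (basisIndex H) ℂ H := (exists_hilbertBasis ℂ H).choose_spec.choose

/-- The Hilbert–Schmidt norm `|A|₂ = Tr(A* A)^{1/2} = (∑ i, ‖A eᵢ‖²)^{1/2}` with values in
`[0, ∞]`; it is finite exactly on the Hilbert–Schmidt operators. It does not depend on the
orthonormal basis, see `hsNorm_eq`. -/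
def hsNorm (A : H →L[ℂ] H) : ℝ≥0∞ :=
  (∑' i, ‖A (basis H i)‖ₑ ^ 2) ^ (1 / 2 : ℝ)

theorem tsum_adjoint {ι κ : Type*} (b : HilbertBasis ι ℂ H) (c : HilbertBasis κ ℂ H)
    (A : H →L[ℂ] H) :
    ∑' i, ‖A (b i)‖ₑ ^ 2 = ∑' j, ‖ContinuousLinearMap.adjoint A (c j)‖ₑ ^ 2 := by
  simp_rw [← parseval c (A _), ← parseval b (ContinuousLinearMap.adjoint A _)]
  rw [ENNReal.tsum_comm]
  refine tsum_congr fun j => tsum_congr fun i => ?_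
  rw [ContinuousLinearMap.adjoint_inner_right, ← inner_conj_symm, RCLike.enorm_conj]

theorem hsNorm_eq {ι : Type*} (b : HilbertBasis ι ℂ H) (A : H →L[ℂ] H) :
    hsNorm A = (∑' i, ‖A (b i)‖ₑ ^ 2) ^ (1 / 2 : ℝ) := by
  rw [hsNorm, tsum_adjoint (basis H) (basis H) A, tsum_adjoint b (basis H) A]

theorem hsNorm_adjoint (A : H →L[ℂ] H) : hsNorm (ContinuousLinearMap.adjoint A) = hsNorm A := by
  rw [hsNorm, hsNorm, ← tsum_adjoint (basis H) (basis H) A]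

theorem hsNorm_mul_le (A B : H →L[ℂ] H) : hsNorm (A * B) ≤ ‖A‖ₑ * hsNorm B := by
  have h : ‖A‖ₑ = (‖A‖ₑ ^ 2) ^ (1 / 2 : ℝ) := by
    rw [← ENNReal.rpow_natCast, ← ENNReal.rpow_mul]; norm_num
  rw [hsNorm, hsNorm, h, ← ENNReal.mul_rpow_of_nonneg _ _ (by norm_num), ← ENNReal.tsum_mul_left]
  gcongr with i
  rw [← mul_pow]
  gcongr
  exact A.le_opENorm _

theorem hsNorm_mul_le' (A B : H →L[ℂ] H) : hsNorm (A * B) ≤ hsNorm A * ‖B‖ₑ := by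
  rw [← hsNorm_adjoint (A * B), ← hsNorm_adjoint A, mul_comm]
  have h : ContinuousLinearMap.adjoint (A * B)
      = ContinuousLinearMap.adjoint B * ContinuousLinearMap.adjoint A :=
    ContinuousLinearMap.adjoint_comp A B
  have h2 : ‖B‖ₑ = ‖ContinuousLinearMap.adjoint B‖ₑ := by
    rw [← ofReal_norm, ← ofReal_norm, LinearIsometryEquiv.norm_map]
  rw [h, h2]
  exact hsNorm_mul_le _ _

theorem hsNorm_add_le (A B : H →L[ℂ] H) : hsNorm (A + B) ≤ 2 * (hsNorm A + hsNorm B) := by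
  have key : ∀ a b : ℝ≥0∞, (a + b) ^ 2 ≤ 4 * (a ^ 2 + b ^ 2) := by
    intro a b
    rcases le_total a b with h | h
    · calc (a + b) ^ 2 ≤ (b + b) ^ 2 := by gcongr
        _ = 4 * b ^ 2 := by ring
        _ ≤ _ := by gcongr; exact le_add_self
    · calc (a + b) ^ 2 ≤ (a + a) ^ 2 := by gcongr
        _ = 4 * a ^ 2 := by ring
        _ ≤ _ := by gcongr; exact le_self_add
  have h4 : (4 : ℝ≥0∞) ^ (1 / 2 : ℝ) = 2 := by
    have : (4 : ℝ≥0∞) = 2 ^ (2 : ℝ) := by norm_num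
    rw [this, ← ENNReal.rpow_mul]; norm_num
  calc hsNorm (A + B)
      ≤ (4 * (∑' i, ‖A (basis H i)‖ₑ ^ 2 + ∑' i, ‖B (basis H i)‖ₑ ^ 2)) ^ (1 / 2 : ℝ) := by
        rw [hsNorm, ← ENNReal.tsum_add, ← ENNReal.tsum_mul_left]
        gcongr with i
        refine le_trans ?_ (key _ _)
        gcongr
        exact enorm_add_le _ _
    _ ≤ _ := by
        rw [ENNReal.mul_rpow_of_nonneg _ _ (by norm_num), h4]
        gcongr
        exact ENNReal.rpow_add_le_add_rpow _ _ (by norm_num) (by norm_num)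

end HilbertSchmidt

/-! ### Essentially Lipschitz functions and multiplication operators -/

/-- Lebesgue measure `λ` on a subset `Ω` of the complex plane. -/
abbrev leb (Ω : Set ℂ) : Measure ℂ := volume.restrict Ω

/-- The Hilbert space `L²(Ω, λ)`. -/
abbrev L2 (Ω : Set ℂ) : Type := Lp ℂ 2 (leb Ω)

/-- The algebra `B(L²(Ω, λ))` of bounded operators. -/
abbrev Op (Ω : Set ℂ) : Type := L2 Ω →L[ℂ] L2 Ω

/-- The space `L^∞(Ω, λ)` of complex-valued functions. -/
abbrev LInf (Ω : Set ℂ) : Type := Lp ℂ ∞ (leb Ω)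

/-- The operator of multiplication by `f ∈ L^∞(Ω, λ)` on `L²(Ω, λ)`. -/
def mulOp {Ω : Set ℂ} (f : LInf Ω) : Op Ω :=
  (ContinuousLinearMap.mul ℂ ℂ).holderL (leb Ω) ∞ 2 2 f

theorem mulOp_coeFn {Ω : Set ℂ} (f : LInf Ω) (h : L2 Ω) :
    mulOp f h =ᵐ[leb Ω] fun z => f z * h z :=
  ContinuousLinearMap.coeFn_holder _ _ _

/-- The difference quotient `Df(s,t) = (f(s) - f(t)) / (s - t)`, `s ≠ t`. (The diagonal is a null
set; there the value is `0`.) -/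
def diffQuot (f : ℂ → ℂ) (p : ℂ × ℂ) : ℂ := (f p.1 - f p.2) / (p.1 - p.2)

/-- The `L^∞(Ω × Ω, λ ⊗ λ)`-norm of the difference quotient of `f`. -/
def lipNorm {Ω : Set ℂ} (f : LInf Ω) : ℝ≥0∞ :=
  eLpNorm (diffQuot f) ∞ ((leb Ω).prod (leb Ω))

/-- The set `Λ(Ω)` of essentially Lipschitz functions in `L^∞(Ω, λ)`. -/
def Lam (Ω : Set ℂ) : Set (LInf Ω) :=
  {f | MemLp (diffQuot f) ∞ ((leb Ω).prod (leb Ω))}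

/-! ### The seminorm `L` and the algebra `EΛ(Ω)` -/

/-- `L(T) = sup {|[M_f, T]|₂ : f ∈ Λ(Ω), ‖Df‖_∞ ≤ 1}`, with values in `[0, ∞]`. -/
def L {Ω : Set ℂ} (T : Op Ω) : ℝ≥0∞ :=
  ⨆ f ∈ Lam Ω, ⨆ _ : lipNorm f ≤ 1, hsNorm (mulOp f * T - T * mulOp f)

theorem le_L {Ω : Set ℂ} (T : Op Ω) {f : LInf Ω} (hf : f ∈ Lam Ω) (h : lipNorm f ≤ 1) :
    hsNorm (mulOp f * T - T * mulOp f) ≤ L T :=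
  le_iSup₂_of_le f hf (le_iSup_of_le h le_rfl)

theorem mulOp_smul_comm {Ω : Set ℂ} (f : LInf Ω) (c : ℂ) :
    mulOp f * algebraMap ℂ (Op Ω) c - algebraMap ℂ (Op Ω) c * mulOp f = 0 := by
  rw [Algebra.commutes c (mulOp f), sub_self]

theorem L_algebraMap {Ω : Set ℂ} (c : ℂ) : L (algebraMap ℂ (Op Ω) c) = 0 := by
  simp [L, mulOp_smul_comm, hsNorm]

theorem L_add_le {Ω : Set ℂ} (S T : Op Ω) : L (S + T) ≤ 2 * (L S + L T) := by
  refine iSup₂_le fun f hf => iSup_le fun h => ?_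
  have e : mulOp f * (S + T) - (S + T) * mulOp f
      = (mulOp f * S - S * mulOp f) + (mulOp f * T - T * mulOp f) := by noncomm_ring
  rw [e]
  refine (hsNorm_add_le _ _).trans ?_
  gcongr
  · exact le_L S hf h
  · exact le_L T hf h

theorem L_mul_le {Ω : Set ℂ} (S T : Op Ω) : L (S * T) ≤ 2 * (L S * ‖T‖ₑ + ‖S‖ₑ * L T) := by
  refine iSup₂_le fun f hf => iSup_le fun h => ?_
  have e : mulOp f * (S * T) - (S * T) * mulOp f
      = (mulOp f * S - S * mulOp f) * T + S * (mulOp f * T - T * mulOp f) := by noncomm_ring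
  rw [e]
  refine (hsNorm_add_le _ _).trans ?_
  gcongr
  · exact (hsNorm_mul_le' _ _).trans (by gcongr; exact le_L S hf h)
  · exact (hsNorm_mul_le _ _).trans (by gcongr; exact le_L T hf h)

/-- The algebra `EΛ(Ω) = {T ∈ B(L²(Ω, λ)) : L(T) < ∞}`. -/
def EΛ (Ω : Set ℂ) : Subalgebra ℂ (Op Ω) where
  carrier := {T | L T < ∞}
  algebraMap_mem' c := by
    change L (algebraMap ℂ (Op Ω) c) < ∞
    simp [L_algebraMap]
  add_mem' {S T} hS hT := by
    exact (L_add_le S T).trans_lt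
      (ENNReal.mul_lt_top ENNReal.ofNat_lt_top (ENNReal.add_lt_top.2 ⟨hS, hT⟩))
  mul_mem' {S T} hS hT := by
    exact (L_mul_le S T).trans_lt (ENNReal.mul_lt_top ENNReal.ofNat_lt_top (ENNReal.add_lt_top.2
      ⟨ENNReal.mul_lt_top hS enorm_lt_top, ENNReal.mul_lt_top enorm_lt_top hT⟩))

/-! ### The operators `U(w)` and `Z`, and the seminorm `L₁` -/

theorem memLp_e (Ω : Set ℂ) (w : ℂ) :
    MemLp (fun z : ℂ => Complex.exp (Complex.I * ((z * conj w).re : ℂ))) ∞ (leb Ω) := by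
  refine memLp_top_of_bound (Continuous.aestronglyMeasurable (by fun_prop)) 1 (.of_forall ?_)
  intro z
  rw [mul_comm, Complex.norm_exp_ofReal_mul_I]

/-- The function `(e(w))(z) = exp(i Re(z w̄))` on `Ω`. -/
def e (Ω : Set ℂ) (w : ℂ) : LInf Ω := (memLp_e Ω w).toLp _

/-- The operator `U(w)` of multiplication by `e(w)`. -/
def U (Ω : Set ℂ) (w : ℂ) : Op Ω := mulOp (e Ω w)

/-- `L₁(T) = sup {|w|⁻¹ |[T, U(w)]|₂ : w ∈ ℂ, w ≠ 0}`, with values in `[0, ∞]`. -/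
def L₁ {Ω : Set ℂ} (T : Op Ω) : ℝ≥0∞ :=
  ⨆ w : ℂ, ⨆ _ : w ≠ 0, ‖w‖ₑ⁻¹ * hsNorm (T * U Ω w - U Ω w * T)

theorem memLp_id {Ω : Set ℂ} (hΩ : MeasurableSet Ω) (hb : Bornology.IsBounded Ω) :
    MemLp (fun z : ℂ => z) ∞ (leb Ω) := by
  obtain ⟨C, hC⟩ := hb.exists_norm_le
  refine memLp_top_of_bound continuous_id.aestronglyMeasurable C ?_
  filter_upwards [ae_restrict_mem hΩ] with z hz using hC z hz

/-- For bounded `Ω`, the operator `Z` of multiplication by the coordinate function `z`. -/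
def Z {Ω : Set ℂ} (hΩ : MeasurableSet Ω) (hb : Bornology.IsBounded Ω) : Op Ω :=
  mulOp ((memLp_id hΩ hb).toLp _)

/-! ### Norms on `EΛ(Ω)` -/

/-- The norm `|||T||| = ‖T‖ + L(T)` on `EΛ(Ω)`. -/
def triNorm {Ω : Set ℂ} (T : EΛ Ω) : ℝ := ‖(T : Op Ω)‖ + (L (T : Op Ω)).toReal

/-- The norm `|||T|||₁ = ‖T‖ + L₁(T)` on `EΛ(Ω)`. -/
def triNorm₁ {Ω : Set ℂ} (T : EΛ Ω) : ℝ := ‖(T : Op Ω)‖ + (L₁ (T : Op Ω)).toReal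

/-- `p` is a Banach algebra norm on the complex algebra `A`: an algebra norm (a norm of complex
vector spaces with `p (x * y) ≤ p x * p y`) whose metric is complete. -/
def IsBanachAlgebraNorm {A : Type*} [Ring A] [Algebra ℂ A] (p : A → ℝ) : Prop :=
  ∃ N : AlgebraNorm ℂ A, (∀ x, N x = p x) ∧
    @CompleteSpace A N.toRingNorm.toNormedRing.toMetricSpace.toUniformSpace

/-- Equivalence of two norms. -/
def NormEquivalent {A : Type*} (p q : A → ℝ) : Prop :=
  ∃ c C : ℝ, 0 < c ∧ 0 < C ∧ ∀ x, c * p x ≤ q x ∧ q x ≤ C * p x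

end

end ELam

namespace ELam

noncomputable section

/-! ### More on the Hilbert–Schmidt norm -/

section HilbertSchmidt

variable {H : Type*} [NormedAddCommGroup H] [InnerProductSpace ℂ H] [CompleteSpace H]

/-! Everything rests on one inequality, `hsNorm_commutator_le`: if `T` lives on a bounded set `B`,
`Z_B` is multiplication by `z` on `B`, and `f` has essential Lipschitz constant at most 1, then
`|[M_f, T]|₂ ≤ |[Z_B, T]|₂`.

Formally, if `T` has kernel `k`, then `[Z_B, T]` has kernel `K = (s - t) k` and `[M_f, T]` has
kernel `Df · K`. But only `[Z_B, T]` need be Hilbert–Schmidt, so `T` itself may have no kernel.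
Instead let `Y` be the operator with kernel `Df · K`. Comparing kernels and using `[M_f, Z_B] = 0`,
one gets `[Z_B, Y] = [M_f, [Z_B, T]] = [Z_B, [M_f, T]]`, so `W = Y - [M_f, T]` commutes with `Z_B`.
A Fuglede-type argument shows that `W` commutes with the projections onto all closed discs
(`commute_proj_closedBall`). Now cut `B` into finitely many pieces of diameter at most `2δ`. `W` is
block diagonal; the blocks of `Y` only see its kernel near the diagonal, and on each piece `f` is
within `2δ` of a constant, so the blocks of `[M_f, T]` are `O(δ)`. Letting `δ → 0` gives `W = 0`
(`eq_zero_of_commute`), hence `|[M_f, T]|₂ = |Y|₂ ≤ ‖K‖₂`.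

For bounded `Ω` this is (3), since `z` is itself an admissible `f`. In general `L₁ ≤ L` because
`e(w)/|w|` is admissible. For `L ≤ 2 L₁`, compress `T` to a disc, write `z = Re z + i Im z`, and
obtain each real linear part as a strong limit of difference quotients of `t ↦ U(tw)`; lower
semicontinuity of the Hilbert–Schmidt norm does the rest. The same semicontinuity yields
completeness in (2). -/

theorem hsNorm_sq (A : H →L[ℂ] H) : hsNorm A ^ 2 = ∑' i, ‖A (basis H i)‖ₑ ^ 2 := by
  rw [hsNorm, ← ENNReal.rpow_natCast, ← ENNReal.rpow_mul]; norm_num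

theorem hsNorm_le_iff (A : H →L[ℂ] H) (C : ℝ≥0∞) :
    hsNorm A ≤ C ↔ ∑' i, ‖A (basis H i)‖ₑ ^ 2 ≤ C ^ 2 := by
  rw [← hsNorm_sq, ENNReal.pow_le_pow_left_iff two_ne_zero]

theorem hsNorm_neg (A : H →L[ℂ] H) : hsNorm (-A) = hsNorm A := by simp [hsNorm]

theorem hsNorm_sub_comm (A B : H →L[ℂ] H) : hsNorm (A - B) = hsNorm (B - A) := by
  rw [← hsNorm_neg, neg_sub]

/-- Minkowski in `ℓ²`, via counting measure. The sharp constant is essential: the cruder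
`hsNorm_add_le` would spoil both the factor 2 in `L ≤ 2 L₁` and the norm axioms. -/
theorem hsNorm_triangle (A B : H →L[ℂ] H) : hsNorm (A + B) ≤ hsNorm A + hsNorm B := by
  let _ : MeasurableSpace (basisIndex H) := ⊤
  have h := ENNReal.lintegral_Lp_add_le (μ := Measure.count) (p := 2)
    (f := fun i : basisIndex H => ‖A (basis H i)‖ₑ) (g := fun i => ‖B (basis H i)‖ₑ)
    (measurable_from_top.aemeasurable) (measurable_from_top.aemeasurable) (by norm_num)
  simp only [lintegral_count, Pi.add_apply] at h
  simp only [hsNorm]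
  norm_cast at h ⊢
  refine le_trans ?_ h
  gcongr with i
  exact enorm_add_le _ _

theorem hsNorm_smul (c : ℂ) (A : H →L[ℂ] H) : hsNorm (c • A) = ‖c‖ₑ * hsNorm A := by
  have h : ‖c‖ₑ = (‖c‖ₑ ^ 2) ^ (1 / 2 : ℝ) := by
    rw [← ENNReal.rpow_natCast, ← ENNReal.rpow_mul]; norm_num
  rw [hsNorm, hsNorm, h, ← ENNReal.mul_rpow_of_nonneg _ _ (by norm_num), ← ENNReal.tsum_mul_left]
  simp [enorm_smul, mul_pow]

/-- The Hilbert–Schmidt norm is lower semicontinuous for the strong operator topology. -/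
theorem hsNorm_le_of_tendsto {ι : Type*} {l : Filter ι} [l.NeBot] {A : ι → H →L[ℂ] H}
    {B : H →L[ℂ] H} {C : ℝ≥0∞} (h : ∀ x, Filter.Tendsto (fun n => A n x) l (nhds (B x)))
    (hC : ∀ᶠ n in l, hsNorm (A n) ≤ C) : hsNorm B ≤ C := by
  rw [hsNorm_le_iff, ENNReal.tsum_eq_iSup_sum]
  refine iSup_le fun s => ?_
  have ht : Filter.Tendsto (fun n => ∑ i ∈ s, ‖A n (basis H i)‖ₑ ^ 2) l
      (nhds (∑ i ∈ s, ‖B (basis H i)‖ₑ ^ 2)) :=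
    tendsto_finsetSum _ fun i _ => ENNReal.Tendsto.pow (h _).enorm
  refine le_of_tendsto ht ?_
  filter_upwards [hC] with n hn
  exact (ENNReal.sum_le_tsum s).trans ((hsNorm_le_iff _ _).1 hn)

/-- Parseval in the range turns the Hilbert–Schmidt norm into the `ℓ²` norm of the matrix entries,
the form in which it can be compared with a kernel. -/
theorem tsum_inner_basis (A : H →L[ℂ] H) :
    ∑' p : basisIndex H × basisIndex H, ‖inner ℂ (basis H p.1) (A (basis H p.2))‖ₑ ^ 2
      = hsNorm A ^ 2 := by
  rw [hsNorm_sq, ENNReal.tsum_prod (f := fun i j => ‖inner ℂ (basis H i) (A (basis H j))‖ₑ ^ 2),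
    ENNReal.tsum_comm]
  exact tsum_congr fun j => parseval (basis H) (A (basis H j))

theorem ext_basis {A B : H →L[ℂ] H} (h : ∀ i, A (basis H i) = B (basis H i)) : A = B := by
  refine ContinuousLinearMap.ext_on (s := Set.range (basis H)) ?_ ?_
  · have := (basis H).dense_span
    rw [Submodule.dense_iff_topologicalClosure_eq_top]
    exact this
  · rintro _ ⟨i, rfl⟩
    exact h i

end HilbertSchmidt

theorem _root_.Orthonormal.tsum_enorm_inner_sq_le {H ι : Type*} [NormedAddCommGroup H]
    [InnerProductSpace ℂ H] {v : ι → H} (hv : Orthonormal ℂ v) (x : H) :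
    ∑' i, ‖inner ℂ (v i) x‖ₑ ^ 2 ≤ ‖x‖ₑ ^ 2 := by
  have h2 := ENNReal.ofReal_tsum_of_nonneg (f := fun i => ‖(inner ℂ (v i) x : ℂ)‖ ^ 2)
    (fun i => by positivity) (hv.inner_products_summable x)
  have h3 := ENNReal.ofReal_le_ofReal (hv.tsum_inner_products_le x)
  rw [h2] at h3
  simpa only [ENNReal.ofReal_pow (norm_nonneg _), ofReal_norm] using h3

/-- Riesz–Fischer. -/
theorem _root_.Orthonormal.exists_inner_eq {H ι : Type*} [NormedAddCommGroup H]
    [InnerProductSpace ℂ H] [CompleteSpace H] {v : ι → H} (hv : Orthonormal ℂ v) (c : ι → ℂ)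
    (hc : ∑' i, ‖c i‖ₑ ^ 2 ≠ ∞) :
    ∃ x : H, (∀ i, inner ℂ (v i) x = c i) ∧ ‖x‖ₑ ^ 2 = ∑' i, ‖c i‖ₑ ^ 2 := by
  classical
  have hs : Summable fun i => ‖c i‖ ^ 2 := by
    have := ENNReal.summable_toReal hc
    simpa using this
  have hm : Memℓp c 2 := by
    rw [memℓp_gen_iff (by norm_num)]
    simpa using hs
  let y : lp (fun _ : ι => ℂ) 2 := ⟨c, hm⟩
  let V := hv.orthogonalFamily
  refine ⟨V.linearIsometry y, fun i => ?_, ?_⟩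
  · have : v i = V.linearIsometry (lp.single 2 i (1 : ℂ)) := by
      rw [OrthogonalFamily.linearIsometry_apply_single]
      simp
    rw [this, LinearIsometry.inner_map_map, lp.inner_single_left]
    simp [y]
  · have h1 := lp.norm_rpow_eq_tsum (p := 2) (by norm_num) y
    have h2 := ENNReal.ofReal_tsum_of_nonneg (f := fun i => ‖c i‖ ^ 2)
      (fun i => by positivity) hs
    simp only [ENNReal.ofReal_pow (norm_nonneg _), ofReal_norm] at h2
    rw [← h2, ← ofReal_norm, ← ENNReal.ofReal_pow (norm_nonneg _), LinearIsometry.norm_map]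
    congr 1
    simpa [y] using h1

/-! ### Integral operators with square integrable kernel -/

section Kernel

variable {α : Type*} [MeasurableSpace α] {μ : Measure α}

theorem memLp_tensor (g h : Lp ℂ 2 μ) :
    MemLp (fun p : α × α => g p.1 * conj (h p.2)) 2 (μ.prod μ) := by
  have hg := Lp.memLp g
  have hh := Lp.memLp h
  have hm : AEStronglyMeasurable (fun p : α × α => g p.1 * conj (h p.2)) (μ.prod μ) :=
    hg.1.comp_fst.mul (Complex.continuous_conj.comp_aestronglyMeasurable hh.1.comp_snd)
  rw [memLp_two_iff_integrable_sq_norm hm]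
  simp only [norm_mul, RCLike.norm_conj, mul_pow]
  exact ((memLp_two_iff_integrable_sq_norm hg.1).1 hg).mul_prod
    ((memLp_two_iff_integrable_sq_norm hh.1).1 hh)

/-- The function `(s, t) ↦ g(s) conj(h(t))`. -/
def tensor (g h : Lp ℂ 2 μ) : Lp ℂ 2 (μ.prod μ) := (memLp_tensor g h).toLp _

theorem tensor_coeFn (g h : Lp ℂ 2 μ) :
    tensor g h =ᵐ[μ.prod μ] fun p => g p.1 * conj (h p.2) := (memLp_tensor g h).coeFn_toLp

theorem ae_fst {P : α → Prop} (h : ∀ᵐ x ∂μ, P x) : ∀ᵐ p ∂μ.prod μ, P p.1 :=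
  Measure.quasiMeasurePreserving_fst.ae h

theorem ae_snd {P : α → Prop} (h : ∀ᵐ x ∂μ, P x) : ∀ᵐ p ∂μ.prod μ, P p.2 :=
  Measure.quasiMeasurePreserving_snd.ae h

/-- `K` is an integral kernel of the operator `X`. -/
def IsKernel (X : Lp ℂ 2 μ →L[ℂ] Lp ℂ 2 μ) (K : α × α → ℂ) : Prop :=
  ∀ g h : Lp ℂ 2 μ, inner ℂ g (X h) = ∫ p, conj (g p.1) * h p.2 * K p ∂μ.prod μ

theorem IsKernel.congr {X : Lp ℂ 2 μ →L[ℂ] Lp ℂ 2 μ} {K K' : α × α → ℂ} (hX : IsKernel X K)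
    (h : K =ᵐ[μ.prod μ] K') : IsKernel X K' := by
  intro g k
  rw [hX g k]
  refine integral_congr_ae ?_
  filter_upwards [h] with p hp
  rw [hp]

theorem IsKernel.ext {X Y : Lp ℂ 2 μ →L[ℂ] Lp ℂ 2 μ} {K : α × α → ℂ} (hX : IsKernel X K)
    (hY : IsKernel Y K) : X = Y := by
  ext1 h
  refine ext_inner_left ℂ fun g => ?_
  rw [hX, hY]

/-- Thus an operator with kernel `K` has the coefficients of `K` against tensors as its matrix
entries. -/
theorem inner_tensor_toLp (g h : Lp ℂ 2 μ) {K : α × α → ℂ} (hK : MemLp K 2 (μ.prod μ)) :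
    inner ℂ (tensor g h) (hK.toLp K) = ∫ p, conj (g p.1) * h p.2 * K p ∂μ.prod μ := by
  rw [L2.inner_def]
  refine integral_congr_ae ?_
  filter_upwards [tensor_coeFn g h, hK.coeFn_toLp] with p h1 h2
  simp only [h1, h2, RCLike.inner_apply, map_mul, RCLike.conj_conj]
  ring

theorem integrable_kernel (g h : Lp ℂ 2 μ) {K : α × α → ℂ} (hK : MemLp K 2 (μ.prod μ)) :
    Integrable (fun p => conj (g p.1) * h p.2 * K p) (μ.prod μ) := by
  refine (L2.integrable_inner (𝕜 := ℂ) (tensor g h) (hK.toLp K)).congr ?_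
  filter_upwards [tensor_coeFn g h, hK.coeFn_toLp] with p h1 h2
  simp only [h1, h2, RCLike.inner_apply, map_mul, RCLike.conj_conj]
  ring

theorem IsKernel.sub {X Y : Lp ℂ 2 μ →L[ℂ] Lp ℂ 2 μ} {K K' : α × α → ℂ}
    (hK : MemLp K 2 (μ.prod μ)) (hK' : MemLp K' 2 (μ.prod μ)) (hX : IsKernel X K)
    (hY : IsKernel Y K') : IsKernel (X - Y) (fun p => K p - K' p) := by
  intro g h
  rw [sub_apply, inner_sub_right, hX, hY,
    ← integral_sub (integrable_kernel g h hK) (integrable_kernel g h hK')]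
  simp only [mul_sub]

variable [SigmaFinite μ]

theorem inner_tensor_tensor (g h g' h' : Lp ℂ 2 μ) :
    inner ℂ (tensor g h) (tensor g' h') = inner ℂ g g' * inner ℂ h' h := by
  rw [L2.inner_def, L2.inner_def, L2.inner_def, ← integral_prod_mul]
  refine integral_congr_ae ?_
  filter_upwards [tensor_coeFn g h, tensor_coeFn g' h'] with p h1 h2
  simp only [h1, h2, RCLike.inner_apply, map_mul, RCLike.conj_conj]
  ring

/-- A square integrable function is the kernel of a Hilbert–Schmidt operator. -/
theorem exists_isKernel {K : α × α → ℂ} (hK : MemLp K 2 (μ.prod μ)) :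
    ∃ X : Lp ℂ 2 μ →L[ℂ] Lp ℂ 2 μ, IsKernel X K := by
  have tadd (g g' h : Lp ℂ 2 μ) : tensor (g + g') h = tensor g h + tensor g' h := by
    refine Lp.ext ?_
    filter_upwards [tensor_coeFn (g + g') h, tensor_coeFn g h, tensor_coeFn g' h,
      Lp.coeFn_add (tensor g h) (tensor g' h), ae_fst (Lp.coeFn_add g g')] with p h1 h2 h3 h4 h5
    rw [h1, h4, Pi.add_apply, h2, h3, h5, Pi.add_apply, add_mul]
  have tadd' (g h h' : Lp ℂ 2 μ) : tensor g (h + h') = tensor g h + tensor g h' := by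
    refine Lp.ext ?_
    filter_upwards [tensor_coeFn g (h + h'), tensor_coeFn g h, tensor_coeFn g h',
      Lp.coeFn_add (tensor g h) (tensor g h'), ae_snd (Lp.coeFn_add h h')] with p h1 h2 h3 h4 h5
    rw [h1, h4, Pi.add_apply, h2, h3, h5, Pi.add_apply, map_add, mul_add]
  have tsmul (c : ℂ) (g h : Lp ℂ 2 μ) : tensor (c • g) h = c • tensor g h := by
    refine Lp.ext ?_
    filter_upwards [tensor_coeFn (c • g) h, tensor_coeFn g h,
      Lp.coeFn_smul c (tensor g h), ae_fst (Lp.coeFn_smul c g)] with p h1 h2 h3 h4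
    rw [h1, h3, Pi.smul_apply, h2, h4, Pi.smul_apply, smul_eq_mul, smul_eq_mul, mul_assoc]
  have tsmul' (c : ℂ) (g h : Lp ℂ 2 μ) : tensor g (c • h) = conj c • tensor g h := by
    refine Lp.ext ?_
    filter_upwards [tensor_coeFn g (c • h), tensor_coeFn g h,
      Lp.coeFn_smul (conj c) (tensor g h), ae_snd (Lp.coeFn_smul c h)] with p h1 h2 h3 h4
    rw [h1, h3, Pi.smul_apply, h2, h4, Pi.smul_apply, smul_eq_mul, smul_eq_mul, map_mul]
    ring
  have tnorm (g h : Lp ℂ 2 μ) : ‖tensor g h‖ = ‖g‖ * ‖h‖ := by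
    have h1 := inner_tensor_tensor g h g h
    rw [inner_self_eq_norm_sq_to_K, inner_self_eq_norm_sq_to_K, inner_self_eq_norm_sq_to_K] at h1
    have h2 : ‖tensor g h‖ ^ 2 = (‖g‖ * ‖h‖) ^ 2 := by rw [mul_pow]; exact_mod_cast h1
    exact (pow_left_inj₀ (norm_nonneg _) (by positivity) two_ne_zero).1 h2
  let k := hK.toLp K
  -- The sesquilinear form `(g, h) ↦ ⟨g ⊗ h̄, K⟩` is bounded by `‖K‖ ‖g‖ ‖h‖` and so represents an
  -- operator. `continuousLinearMapOfBilin` puts that operator on the first argument of the inner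
  -- product, whence the adjoint below.
  let B : Lp ℂ 2 μ →ₗ⋆[ℂ] Lp ℂ 2 μ →ₗ[ℂ] ℂ := LinearMap.mk₂'ₛₗ _ _
    (fun g h : Lp ℂ 2 μ => (inner ℂ (tensor g h) k : ℂ))
    (fun g g' h => by rw [tadd, inner_add_left])
    (fun c g h => by rw [tsmul, inner_smul_left]; rfl)
    (fun g h h' => by rw [tadd', inner_add_left])
    (fun c g h => by rw [tsmul', inner_smul_left]; simp)
  have hB (g h) : ‖B g h‖ ≤ ‖k‖ * ‖g‖ * ‖h‖ := by
    refine (norm_inner_le_norm (𝕜 := ℂ) (tensor g h) k).trans (le_of_eq ?_)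
    rw [tnorm]; ring
  refine ⟨ContinuousLinearMap.adjoint
    (InnerProductSpace.continuousLinearMapOfBilin (B.mkContinuous₂ _ hB)), fun g h => ?_⟩
  rw [ContinuousLinearMap.adjoint_inner_right, InnerProductSpace.continuousLinearMapOfBilin_apply,
    LinearMap.mkContinuous₂_apply]
  exact inner_tensor_toLp g h hK

/-- Completeness of this system is never needed: Bessel bounds an operator by its kernel, and
Riesz–Fischer builds a kernel of exactly the right norm. -/
theorem orthonormal_tensor : Orthonormal ℂ
    (fun p : basisIndex (Lp ℂ 2 μ) × basisIndex (Lp ℂ 2 μ) =>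
      tensor (basis (Lp ℂ 2 μ) p.1) (basis (Lp ℂ 2 μ) p.2)) := by
  classical
  have ho := orthonormal_iff_ite.1 (basis (Lp ℂ 2 μ)).orthonormal
  rw [orthonormal_iff_ite]
  rintro ⟨i, j⟩ ⟨i', j'⟩
  rw [inner_tensor_tensor, ho, ho]
  simp only [Prod.mk.injEq]
  by_cases h1 : i = i' <;> by_cases h2 : j' = j <;> simp [h1, h2, eq_comm (a := j)]

theorem hsNorm_le_of_isKernel {X : Lp ℂ 2 μ →L[ℂ] Lp ℂ 2 μ} {K : α × α → ℂ}
    (hK : MemLp K 2 (μ.prod μ)) (hX : IsKernel X K) : hsNorm X ≤ eLpNorm K 2 (μ.prod μ) := by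
  rw [← ENNReal.pow_le_pow_left_iff two_ne_zero, ← tsum_inner_basis]
  have h := (orthonormal_tensor (μ := μ)).tsum_enorm_inner_sq_le (hK.toLp K)
  rw [Lp.enorm_toLp] at h
  refine le_trans (le_of_eq (tsum_congr fun p => ?_)) h
  rw [hX, inner_tensor_toLp]

/-- Every Hilbert–Schmidt operator on an `L²`-space has a square integrable kernel. -/
theorem exists_kernel {X : Lp ℂ 2 μ →L[ℂ] Lp ℂ 2 μ} (hX : hsNorm X ≠ ∞) :
    ∃ K : α × α → ℂ, MemLp K 2 (μ.prod μ) ∧ IsKernel X K ∧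
      eLpNorm K 2 (μ.prod μ) = hsNorm X := by
  have h2 : hsNorm X ^ 2 ≠ ∞ := ENNReal.pow_ne_top hX
  rw [← tsum_inner_basis] at h2
  obtain ⟨k, hk, hn⟩ := (orthonormal_tensor (μ := μ)).exists_inner_eq _ h2
  refine ⟨k, Lp.memLp k, ?_, ?_⟩
  -- The operator defined by `k` has the same matrix entries as `X`.
  · obtain ⟨Y, hY⟩ := exists_isKernel (Lp.memLp k)
    suffices X = Y by rwa [this]
    refine ext_basis fun j => ?_
    refine (basis (Lp ℂ 2 μ)).repr.injective (lp.ext (funext fun i => ?_))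
    rw [HilbertBasis.repr_apply_apply, HilbertBasis.repr_apply_apply, hY, ← hk (i, j), ← inner_tensor_toLp _ _ (Lp.memLp k), Lp.toLp_coeFn]
  · rw [tsum_inner_basis, (ENNReal.pow_right_strictMono two_ne_zero).injective.eq_iff] at hn
    rw [← hn, Lp.enorm_def]

end Kernel

/-! ### Multiplication operators -/

section Mul

variable {Ω : Set ℂ}

/-- `A` is multiplication by the function `φ`. -/
def IsMul (A : Op Ω) (φ : ℂ → ℂ) : Prop := ∀ h : L2 Ω, A h =ᵐ[leb Ω] fun z => φ z * h z

theorem isMul_mulOp (f : LInf Ω) : IsMul (mulOp f) f := mulOp_coeFn f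

theorem isMul_toLp {φ : ℂ → ℂ} (hφ : MemLp φ ∞ (leb Ω)) : IsMul (mulOp (hφ.toLp φ)) φ := by
  intro h
  filter_upwards [mulOp_coeFn (hφ.toLp φ) h, hφ.coeFn_toLp] with z h1 h2
  rw [h1, h2]

theorem IsMul.congr {A : Op Ω} {φ ψ : ℂ → ℂ} (hA : IsMul A φ) (h : φ =ᵐ[leb Ω] ψ) :
    IsMul A ψ := by
  intro x
  filter_upwards [hA x, h] with z h1 h2
  rw [h1, h2]

theorem IsMul.ext {A B : Op Ω} {φ ψ : ℂ → ℂ} (hA : IsMul A φ) (hB : IsMul B ψ)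
    (h : φ =ᵐ[leb Ω] ψ) : A = B := by
  ext1 x
  refine Lp.ext ?_
  filter_upwards [hA x, hB x, h] with z h1 h2 h3
  rw [h1, h2, h3]

theorem isMul_one : IsMul (1 : Op Ω) 1 := by
  intro x
  simp

theorem IsMul.mul {A B : Op Ω} {φ ψ : ℂ → ℂ} (hA : IsMul A φ) (hB : IsMul B ψ) :
    IsMul (A * B) (fun z => φ z * ψ z) := by
  intro x
  filter_upwards [hA (B x), hB x] with z h1 h2
  rw [mul_apply_eq_comp, h1, h2, mul_assoc]

theorem IsMul.add {A B : Op Ω} {φ ψ : ℂ → ℂ} (hA : IsMul A φ) (hB : IsMul B ψ) :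
    IsMul (A + B) (fun z => φ z + ψ z) := by
  intro x
  filter_upwards [hA x, hB x, Lp.coeFn_add (A x) (B x)] with z h1 h2 h3
  rw [add_apply, h3, Pi.add_apply, h1, h2, add_mul]

theorem IsMul.sub {A B : Op Ω} {φ ψ : ℂ → ℂ} (hA : IsMul A φ) (hB : IsMul B ψ) :
    IsMul (A - B) (fun z => φ z - ψ z) := by
  intro x
  filter_upwards [hA x, hB x, Lp.coeFn_sub (A x) (B x)] with z h1 h2 h3
  rw [sub_apply, h3, Pi.sub_apply, h1, h2, sub_mul]

theorem IsMul.smul {A : Op Ω} {φ : ℂ → ℂ} (hA : IsMul A φ) (c : ℂ) :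
    IsMul (c • A) (fun z => c * φ z) := by
  intro x
  filter_upwards [hA x, Lp.coeFn_smul c (A x)] with z h1 h2
  rw [smul_apply, h2, Pi.smul_apply, h1, smul_eq_mul, mul_assoc]

theorem IsMul.comm {A B : Op Ω} {φ ψ : ℂ → ℂ} (hA : IsMul A φ) (hB : IsMul B ψ) :
    A * B = B * A :=
  (hA.mul hB).ext (hB.mul hA) (.of_forall fun _ => mul_comm _ _)

theorem IsMul.norm_apply_le {A : Op Ω} {φ : ℂ → ℂ} (hA : IsMul A φ) {C : ℝ}
    (hC : ∀ᵐ z ∂leb Ω, ‖φ z‖ ≤ C) (x : L2 Ω) : ‖A x‖ ≤ C * ‖x‖ := by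
  refine Lp.norm_le_mul_norm_of_ae_le_mul ?_
  filter_upwards [hA x, hC] with z h1 h2
  rw [h1, norm_mul]
  gcongr

theorem IsMul.norm_le {A : Op Ω} {φ : ℂ → ℂ} (hA : IsMul A φ) {C : ℝ} (h0 : 0 ≤ C)
    (hC : ∀ᵐ z ∂leb Ω, ‖φ z‖ ≤ C) : ‖A‖ ≤ C :=
  A.opNorm_le_bound h0 (hA.norm_apply_le hC)

theorem IsMul.inner_right {A B : Op Ω} {φ : ℂ → ℂ} (hA : IsMul A φ)
    (hB : IsMul B fun z => conj (φ z)) (g h : L2 Ω) : inner ℂ g (A h) = inner ℂ (B g) h := by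
  rw [L2.inner_def, L2.inner_def]
  refine integral_congr_ae ?_
  filter_upwards [hA h, hB g] with z h1 h2
  simp only [h1, h2, RCLike.inner_apply, map_mul, RCLike.conj_conj]
  ring

theorem memLp_conj {φ : ℂ → ℂ} (hφ : MemLp φ ∞ (leb Ω)) :
    MemLp (fun z => conj (φ z)) ∞ (leb Ω) := hφ.star

theorem exists_ae_bound {φ : ℂ → ℂ} (hφ : MemLp φ ∞ (leb Ω)) :
    ∃ C : ℝ, 0 ≤ C ∧ ∀ᵐ z ∂leb Ω, ‖φ z‖ ≤ C := by
  refine ⟨(eLpNorm φ ∞ (leb Ω)).toReal, ENNReal.toReal_nonneg, ?_⟩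
  rw [eLpNorm_exponent_top]
  filter_upwards [ae_le_eLpNormEssSup (f := φ) (μ := leb Ω)] with z hz
  have h2 := hφ.2.ne
  rw [eLpNorm_exponent_top] at h2
  rw [← toReal_enorm]
  exact ENNReal.toReal_mono h2 hz

variable {X : Op Ω} {K : ℂ × ℂ → ℂ}

theorem memLp_mul_fst {φ : ℂ → ℂ} (hφ : MemLp φ ∞ (leb Ω))
    (hK : MemLp K 2 ((leb Ω).prod (leb Ω))) :
    MemLp (fun p => φ p.1 * K p) 2 ((leb Ω).prod (leb Ω)) := by
  obtain ⟨C, -, hC⟩ := exists_ae_bound hφ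
  refine hK.of_le_mul (c := C) (hφ.1.comp_fst.mul hK.1) ?_
  filter_upwards [ae_fst hC] with p hp
  rw [norm_mul]
  gcongr

theorem memLp_mul_snd {φ : ℂ → ℂ} (hφ : MemLp φ ∞ (leb Ω))
    (hK : MemLp K 2 ((leb Ω).prod (leb Ω))) :
    MemLp (fun p => φ p.2 * K p) 2 ((leb Ω).prod (leb Ω)) := by
  obtain ⟨C, -, hC⟩ := exists_ae_bound hφ
  refine hK.of_le_mul (c := C) (hφ.1.comp_snd.mul hK.1) ?_
  filter_upwards [ae_snd hC] with p hp
  rw [norm_mul]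
  gcongr

theorem IsKernel.mul_left (hX : IsKernel X K) {A : Op Ω} {φ : ℂ → ℂ} (hA : IsMul A φ)
    (hφ : MemLp φ ∞ (leb Ω)) : IsKernel (A * X) (fun p => φ p.1 * K p) := by
  intro g h
  have hB := isMul_toLp (memLp_conj hφ)
  rw [mul_apply_eq_comp, hA.inner_right hB, hX]
  refine integral_congr_ae ?_
  filter_upwards [ae_fst (hB g)] with p hp
  rw [hp, map_mul, RCLike.conj_conj]
  ring

theorem IsKernel.mul_right (hX : IsKernel X K) {A : Op Ω} {φ : ℂ → ℂ} (hA : IsMul A φ) :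
    IsKernel (X * A) (fun p => φ p.2 * K p) := by
  intro g h
  rw [mul_apply_eq_comp, hX]
  refine integral_congr_ae ?_
  filter_upwards [ae_snd (hA h)] with p hp
  rw [hp]
  ring

/-- The kernel of a commutator with a multiplication operator. -/
theorem IsKernel.commutator (hX : IsKernel X K) (hK : MemLp K 2 ((leb Ω).prod (leb Ω)))
    {A : Op Ω} {φ : ℂ → ℂ} (hA : IsMul A φ) (hφ : MemLp φ ∞ (leb Ω)) :
    IsKernel (A * X - X * A) (fun p => (φ p.1 - φ p.2) * K p) := by
  simp only [sub_mul]
  exact (hX.mul_left hA hφ).sub (memLp_mul_fst hφ hK) (memLp_mul_snd hφ hK) (hX.mul_right hA)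

theorem norm_sq_eq_integral (x : L2 Ω) : ‖x‖ ^ 2 = ∫ z, ‖x z‖ ^ 2 ∂leb Ω := by
  have h : ((‖x‖ ^ 2 : ℝ) : ℂ) = ((∫ z, ‖x z‖ ^ 2 ∂leb Ω : ℝ) : ℂ) := by
    rw [← integral_complex_ofReal, Complex.ofReal_pow, Complex.coe_algebraMap.symm,
      ← inner_self_eq_norm_sq_to_K (𝕜 := ℂ), L2.inner_def]
    refine integral_congr_ae (.of_forall fun z => ?_)
    simp only
    rw [inner_self_eq_norm_sq_to_K]
    simp
  exact_mod_cast h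

/-- Dominated convergence for multiplication operators, in the strong operator topology. -/
theorem IsMul.tendsto {A : ℕ → Op Ω} {B : Op Ω} {φ : ℕ → ℂ → ℂ} {ψ : ℂ → ℂ}
    (hA : ∀ n, IsMul (A n) (φ n)) (hB : IsMul B ψ) {C : ℝ}
    (hC : ∀ n, ∀ᵐ z ∂leb Ω, ‖φ n z - ψ z‖ ≤ C)
    (hlim : ∀ᵐ z ∂leb Ω, Filter.Tendsto (fun n => φ n z) Filter.atTop (nhds (ψ z))) (x : L2 Ω) :
    Filter.Tendsto (fun n => A n x) Filter.atTop (nhds (B x)) := by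
  rw [tendsto_iff_norm_sub_tendsto_zero]
  have hi : Integrable (fun z => ‖x z‖ ^ 2) (leb Ω) :=
    (memLp_two_iff_integrable_sq_norm (Lp.memLp x).1).1 (Lp.memLp x)
  have hae (n) : (fun z => ‖(A n x - B x : L2 Ω) z‖ ^ 2) =ᵐ[leb Ω]
      fun z => (‖φ n z - ψ z‖ * ‖x z‖) ^ 2 := by
    filter_upwards [hA n x, hB x, Lp.coeFn_sub (A n x) (B x)] with z h1 h2 h3
    rw [h3, Pi.sub_apply, h1, h2, ← sub_mul, norm_mul]
  have ht : Filter.Tendsto (fun n => ‖A n x - B x‖ ^ 2) Filter.atTop (nhds 0) := by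
    simp only [norm_sq_eq_integral]
    rw [← integral_zero ℂ ℝ (μ := leb Ω)]
    refine tendsto_integral_of_dominated_convergence (fun z => C ^ 2 * ‖x z‖ ^ 2)
      (fun n => (Lp.memLp (A n x - B x)).1.norm.pow 2) (hi.const_mul _) (fun n => ?_) ?_
    · filter_upwards [hae n, hC n] with z h1 h2
      rw [h1, mul_pow, Real.norm_of_nonneg (by positivity)]
      gcongr
    · filter_upwards [ae_all_iff.2 hae, hlim] with z h1 h2
      simp only [h1]
      have := ((tendsto_iff_norm_sub_tendsto_zero.1 h2).mul_const ‖x z‖).pow 2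
      simpa using this
  have := ht.sqrt
  simpa using this

end Mul

/-! ### Operators commuting with multiplication by the coordinate function -/

section Commute

variable {Ω : Set ℂ}

theorem norm_indicator_le {S : Set ℂ} {φ : ℂ → ℂ} {C : ℝ} (h0 : 0 ≤ C)
    (hC : ∀ z ∈ S, ‖φ z‖ ≤ C) (z : ℂ) : ‖S.indicator φ z‖ ≤ C := by
  by_cases h : z ∈ S
  · rw [Set.indicator_of_mem h]; exact hC z h
  · rw [Set.indicator_of_notMem h, norm_zero]; exact h0

theorem memLp_indicator {S : Set ℂ} (hS : MeasurableSet S) {φ : ℂ → ℂ} (hφ : Measurable φ)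
    {C : ℝ} (h0 : 0 ≤ C) (hC : ∀ z ∈ S, ‖φ z‖ ≤ C) : MemLp (S.indicator φ) ∞ (leb Ω) :=
  memLp_top_of_bound (hφ.indicator hS).aestronglyMeasurable C
    (.of_forall (norm_indicator_le h0 hC))

theorem memLp_indicator_one {S : Set ℂ} (hS : MeasurableSet S) :
    MemLp (S.indicator (1 : ℂ → ℂ)) ∞ (leb Ω) :=
  memLp_indicator hS measurable_one zero_le_one (by simp)

variable (Ω) in
/-- Multiplication by the indicator function of `S`. -/
def proj {S : Set ℂ} (hS : MeasurableSet S) : Op Ω := mulOp ((memLp_indicator_one hS).toLp _)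

theorem isMul_proj {S : Set ℂ} (hS : MeasurableSet S) :
    IsMul (proj Ω hS) (S.indicator 1) := isMul_toLp _

theorem norm_proj_apply_le {S : Set ℂ} (hS : MeasurableSet S) (x : L2 Ω) :
    ‖proj Ω hS x‖ ≤ ‖x‖ := by
  simpa using (isMul_proj hS).norm_apply_le
    (.of_forall (norm_indicator_le (φ := 1) zero_le_one (by simp))) x

theorem proj_mul_self {S : Set ℂ} (hS : MeasurableSet S) :
    proj Ω hS * proj Ω hS = proj Ω hS :=
  ((isMul_proj hS).mul (isMul_proj hS)).ext (isMul_proj hS) (.of_forall fun z => by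
    by_cases h : z ∈ S <;> simp [h])

theorem proj_mul_of_subset {S S' : Set ℂ} (hS : MeasurableSet S) (hS' : MeasurableSet S')
    (h : S ⊆ S') : proj Ω hS' * proj Ω hS = proj Ω hS :=
  ((isMul_proj hS').mul (isMul_proj hS)).ext (isMul_proj hS) (.of_forall fun z => by
    by_cases h1 : z ∈ S
    · simp [h1, h h1]
    · simp [h1])

theorem inner_proj {S : Set ℂ} (hS : MeasurableSet S) (g h : L2 Ω) :
    inner ℂ g (proj Ω hS h) = inner ℂ (proj Ω hS g) h :=
  (isMul_proj hS).inner_right ((isMul_proj hS).congr (.of_forall fun z => by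
    by_cases h1 : z ∈ S <;> simp [h1])) g h

theorem norm_proj_sq {S : Set ℂ} (hS : MeasurableSet S) (g : L2 Ω) :
    ‖proj Ω hS g‖ ^ 2 = (inner ℂ g (proj Ω hS g) : ℂ).re := by
  have h : proj Ω hS (proj Ω hS g) = proj Ω hS g := DFunLike.congr_fun (proj_mul_self hS) g
  rw [← h, inner_proj, h, inner_self_eq_norm_sq_to_K]
  norm_cast

/-- If `W` commutes with `Y`, and `p = A Y`, `q` with `Y q = B` are small, then `A W B = 0`. -/
theorem mul_mul_eq_zero {A B Y p q W : Op Ω} (hW : W * Y = Y * W) (hp : A * Y = p)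
    (hpA : p * A = p) (hq : Y * q = B) (hBq : B * q = q) {r s : ℝ} (hpr : ‖p‖ ≤ r)
    (hqs : ‖q‖ ≤ s) (hrs : r * s < 1) : A * W * B = 0 := by
  -- Write `B = Y q`, carry `Y` across `W`, and absorb it into `A`. So `A W B` is a fixed point of
  -- `V ↦ p V q`, which is a strict contraction.
  have h : A * W * B = p * (A * W * B) * q := by
    calc A * W * B = A * (W * Y) * q := by rw [← hq]; noncomm_ring
      _ = (A * Y) * W * q := by rw [hW]; noncomm_ring
      _ = (p * A) * W * (B * q) := by rw [hp, hpA, hBq]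
      _ = _ := by noncomm_ring
  have hn : ‖A * W * B‖ ≤ (r * s) * ‖A * W * B‖ := by
    calc ‖A * W * B‖ = ‖p * (A * W * B) * q‖ := by rw [← h]
      _ ≤ ‖p‖ * ‖A * W * B‖ * ‖q‖ := (norm_mul_le _ _).trans (by gcongr; exact norm_mul_le _ _)
      _ ≤ r * ‖A * W * B‖ * s := by
        have := (norm_nonneg p).trans hpr
        gcongr
      _ = _ := by ring
  have := norm_nonneg (A * W * B)
  exact norm_eq_zero.1 (by nlinarith)

theorem mul_mul_eq_zero' {A B Y p q W : Op Ω} (hW : W * Y = Y * W) (hp : Y * A = p)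
    (hpA : A * p = p) (hq : q * Y = B) (hBq : q * B = q) {r s : ℝ} (hpr : ‖p‖ ≤ r)
    (hqs : ‖q‖ ≤ s) (hrs : r * s < 1) : B * W * A = 0 := by
  have h : B * W * A = q * (B * W * A) * p := by
    calc B * W * A = q * (Y * W) * A := by rw [← hq]; noncomm_ring
      _ = q * W * (Y * A) := by rw [← hW]; noncomm_ring
      _ = (q * B) * W * (A * p) := by rw [hp, hpA, hBq]
      _ = _ := by noncomm_ring
  have hn : ‖B * W * A‖ ≤ (r * s) * ‖B * W * A‖ := by
    calc ‖B * W * A‖ = ‖q * (B * W * A) * p‖ := by rw [← h]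
      _ ≤ ‖q‖ * ‖B * W * A‖ * ‖p‖ := (norm_mul_le _ _).trans (by gcongr; exact norm_mul_le _ _)
      _ ≤ s * ‖B * W * A‖ * r := by
        have := (norm_nonneg q).trans hqs
        gcongr
      _ = _ := by ring
  have := norm_nonneg (B * W * A)
  exact norm_eq_zero.1 (by nlinarith)

variable {W Zb : Op Ω} {B : Set ℂ}

/-- With `Y = Z_B - c`, the part of `Y` on the disc of radius `r` has norm at most `r`, while on the
points of `B` at distance at least `R` from `c` it has an inverse of norm at most `1 / R`. As `r / R
< 1`, the contraction argument applies, in both orders. No commutation of `W` with the adjoint of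
`Z_B` is required. -/
theorem proj_separated (hB : MeasurableSet B) (hZ : IsMul Zb (B.indicator id)) (hc : W * Zb = Zb * W) (c : ℂ) {r R : ℝ}
    (hr : 0 ≤ r) (hR : r < R) :
    proj Ω (hB.inter (Metric.isClosed_closedBall (x := c) (ε := r)).measurableSet) * W *
        proj Ω (hB.diff (Metric.isOpen_ball (x := c) (ε := R)).measurableSet) = 0 ∧
      proj Ω (hB.diff (Metric.isOpen_ball (x := c) (ε := R)).measurableSet) * W *
        proj Ω (hB.inter (Metric.isClosed_closedBall (x := c) (ε := r)).measurableSet) = 0 := by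
  set hS := hB.inter (Metric.isClosed_closedBall (x := c) (ε := r)).measurableSet
  set hS' := hB.diff (Metric.isOpen_ball (x := c) (ε := R)).measurableSet
  have hR0 : 0 < R := hr.trans_lt hR
  have bp : ∀ z ∈ B ∩ Metric.closedBall c r, ‖z - c‖ ≤ r := fun z hz => by
    simpa [dist_eq_norm] using hz.2
  have bq : ∀ z ∈ B \ Metric.ball c R, ‖(z - c)⁻¹‖ ≤ R⁻¹ := fun z hz => by
    have : R ≤ ‖z - c‖ := by simpa [dist_eq_norm] using hz.2
    rw [norm_inv]
    gcongr
  have ip := isMul_toLp (Ω := Ω) (memLp_indicator hS (φ := fun z => z - c) (by fun_prop) hr bp)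
  have iq := isMul_toLp (Ω := Ω) (memLp_indicator hS' (φ := fun z => (z - c)⁻¹) (by fun_prop)
    (by positivity) bq)
  have iY := hZ.sub (isMul_one.smul c)
  have iA := isMul_proj (Ω := Ω) hS
  have iB := isMul_proj (Ω := Ω) hS'
  have np := ip.norm_le hr (.of_forall (norm_indicator_le hr bp))
  have nq := iq.norm_le (by positivity) (.of_forall (norm_indicator_le (by positivity) bq))
  have hYW : W * (Zb - c • 1) = (Zb - c • 1) * W := by
    rw [mul_sub, sub_mul, hc, mul_smul_comm, smul_mul_assoc, one_mul, mul_one]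
  have hrs : r * R⁻¹ < 1 := by rwa [← div_eq_mul_inv, div_lt_one hR0]
  have e1 := (iY.mul iA).ext ip (.of_forall fun z => by
    by_cases h : z ∈ B ∩ Metric.closedBall c r
    · simp only [Set.indicator_of_mem h, Set.indicator_of_mem h.1]; simp
    · simp only [Set.indicator_of_notMem h]; simp)
  have e2 := (iA.mul ip).ext ip (.of_forall fun z => by
    by_cases h : z ∈ B ∩ Metric.closedBall c r
    · simp only [Set.indicator_of_mem h]; simp
    · simp only [Set.indicator_of_notMem h]; simp)
  have e3 := (iY.mul iq).ext iB (.of_forall fun z => by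
    by_cases h : z ∈ B \ Metric.ball c R
    · have h2 : R ≤ ‖z - c‖ := by simpa [dist_eq_norm] using h.2
      have h3 : z - c ≠ 0 := norm_pos_iff.1 (hR0.trans_le h2)
      simp only [Set.indicator_of_mem h, Set.indicator_of_mem h.1]
      simp [h3]
    · simp only [Set.indicator_of_notMem h]; simp)
  have e4 := (iB.mul iq).ext iq (.of_forall fun z => by
    by_cases h : z ∈ B \ Metric.ball c R
    · simp only [Set.indicator_of_mem h]; simp
    · simp only [Set.indicator_of_notMem h]; simp)
  exact ⟨mul_mul_eq_zero hYW ((iA.comm iY).trans e1) ((ip.comm iA).trans e2) e3 e4 np nq hrs,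
    mul_mul_eq_zero' hYW e1 e2 ((iq.comm iY).trans e3) ((iq.comm iB).trans e4) np nq hrs⟩

/-- Let the outer radius decrease to `r`: the separated sets exhaust the complement of the closed
disc in `B`. Both off-diagonal blocks of `W` then vanish, so `W` commutes with the projection. -/
theorem commute_proj_closedBall (hB : MeasurableSet B)
    (hW : proj Ω hB * W = W) (hW' : W * proj Ω hB = W)
    (hZ : IsMul Zb (B.indicator id)) (hc : W * Zb = Zb * W) (c : ℂ) {r : ℝ} (hr : 0 ≤ r) :
    Commute W (proj Ω (Metric.isClosed_closedBall (x := c) (ε := r)).measurableSet) := by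
  set hD := (Metric.isClosed_closedBall (x := c) (ε := r)).measurableSet
  have hsep (n : ℕ) := proj_separated hB hZ hc c hr
    (show r < r + 1 / ((n : ℝ) + 1) by linarith [Nat.one_div_pos_of_nat (α := ℝ) (n := n)])
  have hlim : ∀ x : L2 Ω, Filter.Tendsto (fun n : ℕ => proj Ω (hB.diff (Metric.isOpen_ball
      (x := c) (ε := r + 1 / ((n : ℝ) + 1))).measurableSet) x) Filter.atTop
      (nhds (proj Ω (hB.diff hD) x)) := by
    refine IsMul.tendsto (fun n => isMul_proj _) (isMul_proj _) (C := 1 + 1) (fun n => ?_) ?_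
    · refine .of_forall fun z => (norm_sub_le _ _).trans (add_le_add ?_ ?_) <;>
        exact norm_indicator_le (φ := 1) zero_le_one (by simp) z
    · refine .of_forall fun z => ?_
      by_cases h : z ∈ B \ Metric.closedBall c r
      · have h2 : r < dist z c := by simpa using h.2
        have h3 : ∀ᶠ n : ℕ in Filter.atTop, r + 1 / ((n : ℝ) + 1) < dist z c := by
          have := (tendsto_one_div_add_atTop_nhds_zero_nat (𝕜 := ℝ)).const_add r
          rw [add_zero] at this
          exact this.eventually_lt_const h2
        refine tendsto_const_nhds.congr' ?_
        filter_upwards [h3] with n hn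
        rw [Set.indicator_of_mem h, Set.indicator_of_mem]
        exact ⟨h.1, by simpa using hn.le⟩
      -- A point outside the limit set lies in none of the approximating sets, because `r < r + 1 /
      -- (n + 1)`.
      · refine tendsto_const_nhds.congr fun n => ?_
        rw [Set.indicator_of_notMem h, Set.indicator_of_notMem]
        rintro ⟨h1, h2⟩
        refine h ⟨h1, fun h3 => h2 ?_⟩
        have h4 : dist z c ≤ r := by simpa using h3
        have h5 := Nat.one_div_pos_of_nat (α := ℝ) (n := n)
        simp only [Metric.mem_ball]
        linarith
  have z1 : proj Ω (hB.inter hD) * W * proj Ω (hB.diff hD) = 0 := by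
    ext1 x
    refine tendsto_nhds_unique
      ((proj Ω (hB.inter hD) * W).continuous.continuousAt.tendsto.comp (hlim x)) ?_
    refine tendsto_const_nhds.congr fun n => ?_
    exact (DFunLike.congr_fun (hsep n).1 x).symm
  have z2 : proj Ω (hB.diff hD) * W * proj Ω (hB.inter hD) = 0 := by
    ext1 x
    refine tendsto_nhds_unique (hlim (W (proj Ω (hB.inter hD) x))) ?_
    refine tendsto_const_nhds.congr fun n => ?_
    exact (DFunLike.congr_fun (hsep n).2 x).symm
  have e1 : proj Ω hD * proj Ω hB = proj Ω (hB.inter hD) :=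
    ((isMul_proj hD).mul (isMul_proj hB)).ext (isMul_proj _) (.of_forall fun z => by
      by_cases h1 : z ∈ B <;> by_cases h2 : z ∈ Metric.closedBall c r <;>
        simp [Set.indicator, h1, Set.mem_inter_iff])
  have e2 : proj Ω (hB.inter hD) + proj Ω (hB.diff hD) = proj Ω hB :=
    ((isMul_proj _).add (isMul_proj _)).ext (isMul_proj hB) (.of_forall fun z => by
      by_cases h1 : z ∈ B <;> by_cases h2 : dist z c ≤ r <;>
        simp [Set.indicator, h1, h2, Set.mem_inter_iff])
  have e1' : proj Ω hB * proj Ω hD = proj Ω (hB.inter hD) := by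
    rw [← e1]; exact (isMul_proj hB).comm (isMul_proj hD)
  set A := proj Ω (hB.inter hD)
  have r1 : W * proj Ω hD = A * W * A := by
    calc W * proj Ω hD = (W * proj Ω hB) * proj Ω hD := by rw [hW']
      _ = W * A := by rw [mul_assoc, e1']
      _ = proj Ω hB * W * A := by rw [hW]
      _ = A * W * A := by rw [← e2, add_mul, add_mul, z2, add_zero]
  have r2 : proj Ω hD * W = A * W * A := by
    calc proj Ω hD * W = proj Ω hD * (proj Ω hB * W) := by rw [hW]
      _ = A * W := by rw [← mul_assoc, e1]
      _ = A * (W * proj Ω hB) := by rw [hW']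
      _ = A * W * A := by rw [← e2, mul_add, mul_add, ← mul_assoc, ← mul_assoc, z1, add_zero]
  exact r1.trans r2.symm

end Commute

/-! ### Commutators with Lipschitz functions -/

section Lipschitz

variable {Ω : Set ℂ}

theorem ae_dist_le {f : LInf Ω} (hf : lipNorm f ≤ 1) :
    ∀ᵐ p ∂(leb Ω).prod (leb Ω), ‖diffQuot f p‖ ≤ 1 ∧ ‖f p.1 - f p.2‖ ≤ ‖p.1 - p.2‖ := by
  rw [lipNorm, eLpNorm_exponent_top] at hf
  filter_upwards [ae_le_eLpNormEssSup (f := diffQuot f) (μ := (leb Ω).prod (leb Ω))] with p hp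
  have h1 : ‖diffQuot f p‖ ≤ 1 := by
    rw [← toReal_enorm]
    simpa using ENNReal.toReal_mono ENNReal.one_ne_top (hp.trans hf)
  refine ⟨h1, ?_⟩
  by_cases h : p.1 = p.2
  · simp [h]
  · rw [diffQuot, norm_div, div_le_one (norm_pos_iff.2 (sub_ne_zero.2 h))] at h1
    exact h1

/-- By Fubini almost every `x` satisfies the Lipschitz bound against almost every `y`. If `S`
contains such an `x`, take `c = f x`; otherwise `S` is negligible and any `c` will do. -/
theorem exists_ae_norm_sub_le {f : LInf Ω} (hf : lipNorm f ≤ 1) {S : Set ℂ} {d : ℝ}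
    (hd : ∀ x ∈ S, ∀ y ∈ S, ‖x - y‖ ≤ d) :
    ∃ c : ℂ, ∀ᵐ z ∂leb Ω, z ∈ S → ‖f z - c‖ ≤ d := by
  have h := Measure.ae_ae_of_ae_prod (ae_dist_le hf)
  by_cases hx : ∃ x ∈ S, ∀ᵐ y ∂leb Ω, ‖f x - f y‖ ≤ ‖x - y‖
  · obtain ⟨x, hxS, hx⟩ := hx
    refine ⟨f x, ?_⟩
    filter_upwards [hx] with z hz hzS
    rw [norm_sub_rev]
    exact hz.trans (hd x hxS z hzS)
  · refine ⟨0, ?_⟩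
    filter_upwards [h] with z hz hzS
    exact absurd ⟨z, hzS, hz.mono fun _ h => h.2⟩ hx

/-- A commutator with a function that is almost constant on `S` is small on `S`. -/
theorem norm_inner_commutator_le {f : LInf Ω} (T : Op Ω) {S : Set ℂ} (hS : MeasurableSet S)
    {c : ℂ} {d : ℝ} (hd : 0 ≤ d) (hc : ∀ᵐ z ∂leb Ω, z ∈ S → ‖f z - c‖ ≤ d) (g h : L2 Ω) :
    ‖(inner ℂ (proj Ω hS g) ((mulOp f * T - T * mulOp f) (proj Ω hS h)) : ℂ)‖ ≤
      2 * d * ‖T‖ * (‖proj Ω hS g‖ * ‖proj Ω hS h‖) := by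
  set P := proj Ω hS
  have iP := isMul_proj (Ω := Ω) hS
  have iF := (isMul_mulOp f).sub (isMul_one.smul c)
  have hb (x : L2 Ω) : ‖(P * (mulOp f - c • 1)) x‖ ≤ d * ‖x‖ := by
    refine (iP.mul iF).norm_apply_le ?_ x
    filter_upwards [hc] with z hz
    by_cases h : z ∈ S
    · simpa [h] using hz h
    · simpa [h] using hd
  have hPP (x : L2 Ω) : P (P x) = P x := DFunLike.congr_fun (proj_mul_self hS) x
  -- Subtracting a constant from `f` does not change the commutator, and `f - c` is at most `d` on
  -- `S`.
  have e : mulOp f * T - T * mulOp f = (mulOp f - c • 1) * T - T * (mulOp f - c • 1) := by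
    simp only [sub_mul, mul_sub, smul_mul_assoc, mul_smul_comm, one_mul, mul_one]
    abel
  have e1 : (inner ℂ (P g) ((mulOp f * T - T * mulOp f) (P h)) : ℂ)
      = inner ℂ (P g) ((P * (mulOp f - c • 1)) (T (P h)))
        - inner ℂ (P g) (T ((P * (mulOp f - c • 1)) (P h))) := by
    have h1 : (P * (mulOp f - c • 1)) (P h) = (mulOp f - c • 1) (P h) := by
      rw [iP.comm iF, mul_apply_eq_comp, hPP]
    have h2 (x : L2 Ω) : (inner ℂ (P g) ((P * (mulOp f - c • 1)) x) : ℂ)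
        = inner ℂ (P g) ((mulOp f - c • 1) x) := by
      rw [mul_apply_eq_comp, inner_proj, hPP]
    rw [h1, h2, e, sub_apply, inner_sub_right, mul_apply_eq_comp, mul_apply_eq_comp]
  rw [e1]
  refine (norm_sub_le _ _).trans ?_
  have b1 : ‖(inner ℂ (P g) ((P * (mulOp f - c • 1)) (T (P h))) : ℂ)‖
      ≤ ‖P g‖ * (d * (‖T‖ * ‖P h‖)) := by
    refine (norm_inner_le_norm _ _).trans ?_
    gcongr
    refine (hb _).trans ?_
    gcongr
    exact T.le_opNorm _
  have b2 : ‖(inner ℂ (P g) (T ((P * (mulOp f - c • 1)) (P h))) : ℂ)‖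
      ≤ ‖P g‖ * (‖T‖ * (d * ‖P h‖)) := by
    refine (norm_inner_le_norm _ _).trans ?_
    gcongr
    refine (T.le_opNorm _).trans ?_
    gcongr
    exact hb _
  linarith

/-- The square `S × S` lies in the strip `‖s - t‖ ≤ d`. The indicator of `S` is kept in the first
variable only, so that the bounds for disjoint sets `S` add up. -/
theorem norm_inner_kernel_le {Y : Op Ω} {K : ℂ × ℂ → ℂ}
    (hK : MemLp K 2 ((leb Ω).prod (leb Ω))) (hY : IsKernel Y K) {S : Set ℂ}
    (hS : MeasurableSet S) {d : ℝ} (hd : ∀ x ∈ S, ∀ y ∈ S, ‖x - y‖ ≤ d) (g h : L2 Ω) :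
    ‖(inner ℂ (proj Ω hS g) (Y (proj Ω hS h)) : ℂ)‖ ≤
      ∫ p, S.indicator 1 p.1 * {q : ℂ × ℂ | ‖q.1 - q.2‖ ≤ d}.indicator
        (fun q => ‖conj (g q.1) * h q.2 * K q‖) p ∂(leb Ω).prod (leb Ω) := by
  have hm : MeasurableSet {q : ℂ × ℂ | ‖q.1 - q.2‖ ≤ d} :=
    measurableSet_le (by fun_prop) (by fun_prop)
  rw [hY]
  refine norm_integral_le_of_norm_le ?_ ?_
  · have h1 := ((integrable_kernel g h hK).norm.indicator hm).indicator (measurable_fst hS)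
    refine h1.congr (.of_forall fun p => ?_)
    by_cases hp : p.1 ∈ S
    · simp [Set.indicator, hp]
    · simp [Set.indicator, hp]
  · filter_upwards [ae_fst (isMul_proj hS g), ae_snd (isMul_proj hS h)] with p h1 h2
    rw [h1, h2]
    by_cases hp : p.1 ∈ S
    · by_cases hp2 : p.2 ∈ S
      · have : p ∈ {q : ℂ × ℂ | ‖q.1 - q.2‖ ≤ d} := hd _ hp _ hp2
        rw [Set.indicator_of_mem hp, Set.indicator_of_mem hp, Set.indicator_of_mem hp2,
          Set.indicator_of_mem this]
        simp
      · rw [Set.indicator_of_notMem hp2]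
        simp only [zero_mul, mul_zero, norm_zero]
        refine mul_nonneg (Set.indicator_nonneg (by simp) _)
          (Set.indicator_nonneg (fun _ _ => norm_nonneg _) _)
    · simp [hp]

/-- The strips shrink to the diagonal, which is a null set since Lebesgue measure has no atoms;
dominated convergence applies. -/
theorem tendsto_integral_near_diagonal {F : ℂ × ℂ → ℝ}
    (hF : Integrable F ((leb Ω).prod (leb Ω))) {d : ℕ → ℝ}
    (hd : Filter.Tendsto d Filter.atTop (nhds 0)) :
    Filter.Tendsto (fun n => ∫ p, {q : ℂ × ℂ | ‖q.1 - q.2‖ ≤ d n}.indicator F p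
      ∂(leb Ω).prod (leb Ω)) Filter.atTop (nhds 0) := by
  have hm (n) : MeasurableSet {q : ℂ × ℂ | ‖q.1 - q.2‖ ≤ d n} :=
    measurableSet_le (by fun_prop) (by fun_prop)
  have hdiag : ∀ᵐ p ∂(leb Ω).prod (leb Ω), p.1 ≠ p.2 := by
    rw [ae_iff]
    have hms : MeasurableSet {p : ℂ × ℂ | ¬ p.1 ≠ p.2} := by
      simpa using measurableSet_eq_fun (f := fun p : ℂ × ℂ => p.1) (g := fun p => p.2)
        measurable_fst measurable_snd
    rw [Measure.measure_prod_null hms]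
    refine .of_forall fun x => ?_
    simp
  rw [← integral_zero (ℂ × ℂ) ℝ (μ := (leb Ω).prod (leb Ω))]
  refine tendsto_integral_of_dominated_convergence (fun p => ‖F p‖)
    (fun n => hF.1.indicator (hm n)) hF.norm (fun n => .of_forall fun p => ?_) ?_
  · exact norm_indicator_le_norm_self _ _
  · filter_upwards [hdiag] with p hp
    have hpos : 0 < ‖p.1 - p.2‖ := norm_pos_iff.2 (sub_ne_zero.2 hp)
    refine tendsto_const_nhds.congr' ?_
    filter_upwards [hd.eventually_lt_const hpos] with n hn
    rw [Set.indicator_of_notMem]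
    simpa using hn

end Lipschitz

/-! ### The main inequality: an operator commuting with disc projections is killed by refinement -/

section Main

variable {Ω : Set ℂ}

/-- Induction on the number of discs: each new disc contributes the piece `Q` not yet covered. Both
terms of the bound are additive over disjoint pieces, so the estimate does not deteriorate with the
number of discs. -/
theorem norm_inner_proj_le_of_commute {W T Y : Op Ω} {f : LInf Ω} {K : ℂ × ℂ → ℂ}
    (hcomm : ∀ (c : ℂ) (r : ℝ), 0 ≤ r →
      Commute W (proj Ω (Metric.isClosed_closedBall (x := c) (ε := r)).measurableSet))
    (hf : lipNorm f ≤ 1) (hK : MemLp K 2 ((leb Ω).prod (leb Ω))) (hY : IsKernel Y K)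
    (hW : W = Y - (mulOp f * T - T * mulOp f)) {δ : ℝ} (hδ : 0 ≤ δ) (g h : L2 Ω)
    {t : Set ℂ} (ht : t.Finite) :
    ∃ hS : MeasurableSet (⋃ c ∈ t, Metric.closedBall c δ), Commute W (proj Ω hS) ∧
      ‖(inner ℂ g (W (proj Ω hS h)) : ℂ)‖ ≤
        (∫ p, (⋃ c ∈ t, Metric.closedBall c δ).indicator 1 p.1 *
          {q : ℂ × ℂ | ‖q.1 - q.2‖ ≤ 2 * δ}.indicator
          (fun q => ‖conj (g q.1) * h q.2 * K q‖) p ∂(leb Ω).prod (leb Ω)) +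
        2 * δ * ‖T‖ * (‖proj Ω hS g‖ ^ 2 + ‖proj Ω hS h‖ ^ 2) := by
  have hm : MeasurableSet {q : ℂ × ℂ | ‖q.1 - q.2‖ ≤ 2 * δ} :=
    measurableSet_le (by fun_prop) (by fun_prop)
  have hG := (integrable_kernel g h hK).norm.indicator hm
  set G := {q : ℂ × ℂ | ‖q.1 - q.2‖ ≤ 2 * δ}.indicator
    (fun q => ‖conj (g q.1) * h q.2 * K q‖) with hGdef
  have hGi {S : Set ℂ} (hS : MeasurableSet S) :
      Integrable (fun p => S.indicator 1 p.1 * G p) ((leb Ω).prod (leb Ω)) := by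
    refine (hG.indicator (measurable_fst hS)).congr (.of_forall fun p => ?_)
    by_cases hp : p.1 ∈ S <;> simp [Set.indicator, hp]
  induction t, ht using Set.Finite.induction_on with
  | empty =>
    simp only [Set.mem_empty_iff_false, Set.iUnion_of_empty, Set.iUnion_empty]
    have h0 : proj Ω MeasurableSet.empty = 0 := by
      have : IsMul (0 : Op Ω) 0 := fun x => by
        simp only [zero_apply, Pi.zero_apply, zero_mul]
        exact Lp.coeFn_zero ℂ 2 (leb Ω)
      exact (isMul_proj _).ext this (.of_forall fun z => by simp)
    exact ⟨MeasurableSet.empty, by simp [h0], by simp [h0]⟩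
  | @insert a s has hs ih =>
    obtain ⟨hE, hcE, hb⟩ := ih
    rw [Set.biUnion_insert]
    set E := ⋃ c ∈ s, Metric.closedBall c δ
    have hD := (Metric.isClosed_closedBall (x := a) (ε := δ)).measurableSet
    have hcD := hcomm a δ hδ
    have hQ := hD.diff hE
    have eQ : proj Ω hQ = proj Ω hD - proj Ω hE * proj Ω hD :=
      (isMul_proj _).ext ((isMul_proj _).sub ((isMul_proj _).mul (isMul_proj _)))
        (.of_forall fun z => by
          by_cases h1 : z ∈ E <;> by_cases h2 : z ∈ Metric.closedBall a δ <;>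
            simp only [Set.indicator, Set.mem_sdiff, h1, h2] <;> simp)
    have eU : proj Ω (hD.union hE) = proj Ω hE + proj Ω hQ :=
      (isMul_proj _).ext ((isMul_proj _).add (isMul_proj _)) (.of_forall fun z => by
          by_cases h1 : z ∈ E <;> by_cases h2 : z ∈ Metric.closedBall a δ <;>
            simp only [Set.indicator, Set.mem_sdiff, Set.mem_union, h1, h2] <;> simp)
    have hcQ : Commute W (proj Ω hQ) := by
      rw [eQ]; exact hcD.sub_right (hcE.mul_right hcD)
    refine ⟨hD.union hE, by rw [eU]; exact hcE.add_right hcQ, ?_⟩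
    have hsq (x : L2 Ω) :
        ‖proj Ω (hD.union hE) x‖ ^ 2 = ‖proj Ω hE x‖ ^ 2 + ‖proj Ω hQ x‖ ^ 2 := by
      rw [norm_proj_sq, norm_proj_sq, norm_proj_sq, eU, add_apply, inner_add_right, Complex.add_re]
    have hint : ∫ p, (Metric.closedBall a δ ∪ E).indicator 1 p.1 * G p ∂(leb Ω).prod (leb Ω)
        = (∫ p, E.indicator 1 p.1 * G p ∂(leb Ω).prod (leb Ω)) +
          ∫ p, (Metric.closedBall a δ \ E).indicator 1 p.1 * G p ∂(leb Ω).prod (leb Ω) := by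
      rw [← integral_add (hGi hE) (hGi hQ)]
      refine integral_congr_ae (.of_forall fun p => ?_)
      by_cases h1 : p.1 ∈ E <;> by_cases h2 : p.1 ∈ Metric.closedBall a δ <;>
        simp only [Set.indicator, Set.mem_sdiff, Set.mem_union, h1, h2] <;> simp
    have hd : ∀ x ∈ Metric.closedBall a δ \ E, ∀ y ∈ Metric.closedBall a δ \ E,
        ‖x - y‖ ≤ 2 * δ := by
      rintro x ⟨hx, -⟩ y ⟨hy, -⟩
      rw [← dist_eq_norm]
      have h1 := Metric.mem_closedBall.1 hx
      have h2 := Metric.mem_closedBall.1 hy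
      linarith [dist_triangle_right x y a]
    obtain ⟨c, hc⟩ := exists_ae_norm_sub_le hf hd
    -- Since `W` commutes with the projection onto `Q`, only its diagonal block at `Q` matters.
    have e1 : (inner ℂ g (W (proj Ω hQ h)) : ℂ)
        = inner ℂ (proj Ω hQ g) (Y (proj Ω hQ h)) - inner ℂ (proj Ω hQ g)
          ((mulOp f * T - T * mulOp f) (proj Ω hQ h)) := by
      rw [← inner_sub_right, ← sub_apply, ← hW, ← inner_proj]
      congr 1
      have h1 := DFunLike.congr_fun hcQ.eq (proj Ω hQ h)
      have h2 := DFunLike.congr_fun (proj_mul_self (Ω := Ω) hQ) h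
      simp only [mul_apply_eq_comp] at h1 h2
      rw [← h1, h2]
    have e2 := norm_inner_kernel_le hK hY hQ hd g h
    have e3 := norm_inner_commutator_le T hQ (by positivity : 0 ≤ 2 * δ) hc g h
    -- `2ab ≤ a² + b²` replaces the product by squares, which are additive over orthogonal pieces.
    have e4 : 2 * (2 * δ) * ‖T‖ * (‖proj Ω hQ g‖ * ‖proj Ω hQ h‖) ≤
        2 * δ * ‖T‖ * (‖proj Ω hQ g‖ ^ 2 + ‖proj Ω hQ h‖ ^ 2) := by
      have : 0 ≤ 2 * δ * ‖T‖ * (‖proj Ω hQ g‖ - ‖proj Ω hQ h‖) ^ 2 := by positivity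
      linarith
    have e5 := norm_sub_le (inner ℂ (proj Ω hQ g) (Y (proj Ω hQ h)) : ℂ)
      (inner ℂ (proj Ω hQ g) ((mulOp f * T - T * mulOp f) (proj Ω hQ h)))
    rw [← e1] at e5
    have e6 : ‖(inner ℂ g (W (proj Ω (hD.union hE) h)) : ℂ)‖ ≤
        ‖(inner ℂ g (W (proj Ω hE h)) : ℂ)‖ + ‖(inner ℂ g (W (proj Ω hQ h)) : ℂ)‖ := by
      rw [eU, add_apply, map_add, inner_add_right]
      exact norm_add_le _ _
    rw [hint, hsq, hsq]
    rw [← hGdef] at e2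
    linarith

/-- Total boundedness covers `B` by finitely many discs of radius `δ`, and the previous estimate
then bounds `⟨g, W h⟩` by a strip integral plus `O(δ)`, both tending to 0. -/
theorem eq_zero_of_commute {W T Y : Op Ω} {f : LInf Ω} {K : ℂ × ℂ → ℂ} {B : Set ℂ}
    (hB : MeasurableSet B) (hb : Bornology.IsBounded B) (hBW : proj Ω hB * W = W)
    (hcomm : ∀ (c : ℂ) (r : ℝ), 0 ≤ r →
      Commute W (proj Ω (Metric.isClosed_closedBall (x := c) (ε := r)).measurableSet))
    (hf : lipNorm f ≤ 1) (hK : MemLp K 2 ((leb Ω).prod (leb Ω))) (hY : IsKernel Y K)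
    (hW : W = Y - (mulOp f * T - T * mulOp f)) : W = 0 := by
  ext1 h
  refine ext_inner_left ℂ fun g => ?_
  rw [zero_apply, inner_zero_right, ← norm_le_zero_iff]
  have hI := integrable_kernel g h hK
  have key {δ : ℝ} (hδ : 0 < δ) : ‖(inner ℂ g (W h) : ℂ)‖ ≤
      (∫ p, {q : ℂ × ℂ | ‖q.1 - q.2‖ ≤ 2 * δ}.indicator
        (fun q => ‖conj (g q.1) * h q.2 * K q‖) p ∂(leb Ω).prod (leb Ω)) +
      2 * δ * ‖T‖ * (‖g‖ ^ 2 + ‖h‖ ^ 2) := by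
    obtain ⟨t, ht, hBt⟩ := Metric.totallyBounded_iff.1 
      (hb.isCompact_closure.totallyBounded.subset subset_closure) δ hδ
    obtain ⟨hS, hcS, hbd⟩ := norm_inner_proj_le_of_commute hcomm hf hK hY hW hδ.le g h ht
    have hBS : B ⊆ ⋃ c ∈ t, Metric.closedBall c δ :=
      hBt.trans (Set.iUnion₂_mono fun _ _ => Metric.ball_subset_closedBall)
    have e : W * proj Ω hS = W := by
      rw [hcS.eq, ← hBW, ← mul_assoc, proj_mul_of_subset hB hS hBS]
    have e' : W (proj Ω hS h) = W h := DFunLike.congr_fun e h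
    rw [e'] at hbd
    have hm : MeasurableSet {q : ℂ × ℂ | ‖q.1 - q.2‖ ≤ 2 * δ} :=
      measurableSet_le (by fun_prop) (by fun_prop)
    refine hbd.trans ?_
    gcongr ?_ + 2 * δ * ‖T‖ * (?_ ^ 2 + ?_ ^ 2)
    · refine integral_mono_of_nonneg (.of_forall fun p => ?_) (hI.norm.indicator hm)
        (.of_forall fun p => ?_)
      · exact mul_nonneg (Set.indicator_nonneg (by simp) _)
          (Set.indicator_nonneg (fun _ _ => norm_nonneg _) _)
      · refine mul_le_of_le_one_left (Set.indicator_nonneg (fun _ _ => norm_nonneg _) _) ?_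
        exact Set.indicator_le_self' (f := (1 : ℂ → ℝ)) (by simp) _
    · exact norm_proj_apply_le hS g
    · exact norm_proj_apply_le hS h
  have hd : Filter.Tendsto (fun n : ℕ => 2 * (1 / ((n : ℝ) + 1))) Filter.atTop (nhds 0) := by
    simpa using (tendsto_one_div_add_atTop_nhds_zero_nat (𝕜 := ℝ)).const_mul 2
  have hlim := (tendsto_integral_near_diagonal hI.norm hd).add
    ((hd.mul_const ‖T‖).mul_const (‖g‖ ^ 2 + ‖h‖ ^ 2))
  simp only [zero_mul, add_zero] at hlim
  exact ge_of_tendsto' hlim fun n => key Nat.one_div_pos_of_nat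

/-- Commutators with functions of Lipschitz constant `1` are dominated in Hilbert–Schmidt norm by
the commutator with the coordinate function, for operators living on a bounded set. -/
theorem hsNorm_commutator_le {B : Set ℂ} (hB : MeasurableSet B) (hb : Bornology.IsBounded B)
    {T Zb : Op Ω} (hT : proj Ω hB * T = T) (hT' : T * proj Ω hB = T)
    (hZ : IsMul Zb (B.indicator id)) {f : LInf Ω} (hf : lipNorm f ≤ 1) :
    hsNorm (mulOp f * T - T * mulOp f) ≤ hsNorm (Zb * T - T * Zb) := by
  by_cases htop : hsNorm (Zb * T - T * Zb) = ∞
  · rw [htop]; exact le_top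
  obtain ⟨K, hK, hX, hn⟩ := exists_kernel htop
  set P := proj Ω hB
  set F := mulOp f * T - T * mulOp f with hF
  have iP : IsMul P (B.indicator 1) := isMul_proj hB
  have iF := isMul_mulOp f
  have mP : MemLp (B.indicator (1 : ℂ → ℂ)) ∞ (leb Ω) := memLp_indicator_one hB
  obtain ⟨C, hC⟩ := hb.exists_norm_le
  have mZ : MemLp (B.indicator id) ∞ (leb Ω) :=
    memLp_indicator hB measurable_id (le_max_left 0 C) fun z hz => (hC z hz).trans (le_max_right _ _)
  -- The kernel is cut down to `B × B`, where the multiplier of `Zb` really is the coordinate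
  -- function.
  have hXP : P * ((Zb * T - T * Zb) * P) = Zb * T - T * Zb := by
    have h1 : P * Zb = Zb * P := iP.comm hZ
    calc P * ((Zb * T - T * Zb) * P)
        = (P * Zb) * (T * P) - (P * T) * (Zb * P) := by noncomm_ring
      _ = Zb * (P * (T * P)) - ((P * T) * P) * Zb := by
        rw [mul_assoc (P * T) P Zb, h1]; noncomm_ring
      _ = _ := by rw [hT', hT, hT']
  have hX' : IsKernel (Zb * T - T * Zb)
      (fun p => B.indicator 1 p.1 * (B.indicator 1 p.2 * K p)) := by
    have := (hX.mul_right iP).mul_left iP mP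
    rwa [hXP] at this
  have hK' := memLp_mul_fst mP (memLp_mul_snd mP hK)
  set K' : ℂ × ℂ → ℂ := fun p => B.indicator 1 p.1 * (B.indicator 1 p.2 * K p)
  have hfm : AEMeasurable f (leb Ω) := (Lp.memLp f).1.aemeasurable
  have hDm : AEStronglyMeasurable (diffQuot f) ((leb Ω).prod (leb Ω)) :=
    AEMeasurable.aestronglyMeasurable ((hfm.comp_fst.sub hfm.comp_snd).div
      (measurable_fst.sub measurable_snd).aemeasurable)
  have hle : ∀ᵐ p ∂(leb Ω).prod (leb Ω), ‖diffQuot f p * K' p‖ ≤ 1 * ‖K' p‖ := by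
    filter_upwards [ae_dist_le hf] with p hp
    rw [norm_mul]
    gcongr
    exact hp.1
  have hL : MemLp (fun p => diffQuot f p * K' p) 2 ((leb Ω).prod (leb Ω)) :=
    hK'.of_le_mul (hDm.mul hK'.1) hle
  have hle' : eLpNorm (fun p => diffQuot f p * K' p) 2 ((leb Ω).prod (leb Ω)) ≤
      eLpNorm K 2 ((leb Ω).prod (leb Ω)) := by
    refine eLpNorm_mono_ae ?_
    filter_upwards [hle] with p hp
    refine hp.trans ?_
    rw [one_mul, norm_mul, norm_mul, ← mul_assoc]
    refine mul_le_of_le_one_left (norm_nonneg _) (mul_le_one₀ ?_ (norm_nonneg _) ?_) <;>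
      exact norm_indicator_le (φ := 1) zero_le_one (by simp) _
  obtain ⟨Y, hY⟩ := exists_isKernel hL
  -- Both kernels agree because `(s - t) Df(s, t) = f(s) - f(t)`; on the diagonal both vanish.
  have hcomm : Zb * Y - Y * Zb = mulOp f * (Zb * T - T * Zb) - (Zb * T - T * Zb) * mulOp f := by
    refine (hY.commutator hL hZ mZ).ext ((hX'.commutator hK' iF (Lp.memLp f)).congr
      (.of_forall fun p => ?_))
    simp only [K', diffQuot]
    by_cases h1 : p.1 ∈ B
    · by_cases h2 : p.2 ∈ B
      · by_cases h3 : p.1 = p.2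
        · simp [h3]
        · have := sub_ne_zero.2 h3
          simp only [Set.indicator_of_mem h1, Set.indicator_of_mem h2, Pi.one_apply, one_mul, id]
          field_simp
      · simp [h2]
    · simp [h1]
  have hfZ : mulOp f * Zb = Zb * mulOp f := iF.comm hZ
  have hfP : P * mulOp f = mulOp f * P := iP.comm iF
  -- The Jacobi identity, with `[M_f, Z_B] = 0`.
  have hFZ : mulOp f * (Zb * T - T * Zb) - (Zb * T - T * Zb) * mulOp f = Zb * F - F * Zb := by
    calc mulOp f * (Zb * T - T * Zb) - (Zb * T - T * Zb) * mulOp f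
        = (mulOp f * Zb) * T - mulOp f * T * Zb - Zb * T * mulOp f + T * (Zb * mulOp f) := by
          noncomm_ring
      _ = (Zb * mulOp f) * T - mulOp f * T * Zb - Zb * T * mulOp f + T * (mulOp f * Zb) := by
          rw [hfZ]
      _ = _ := by rw [hF]; noncomm_ring
  have hPF : P * F = F := by
    calc P * F = (P * mulOp f) * T - (P * T) * mulOp f := by rw [hF]; noncomm_ring
      _ = mulOp f * (P * T) - (P * T) * mulOp f := by rw [hfP]; noncomm_ring
      _ = F := by rw [hT]
  have hFP : F * P = F := by
    calc F * P = mulOp f * (T * P) - T * (mulOp f * P) := by rw [hF]; noncomm_ring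
      _ = mulOp f * (T * P) - (T * P) * mulOp f := by rw [← hfP]; noncomm_ring
      _ = F := by rw [hT']
  have hPY : P * Y = Y := by
    refine (hY.mul_left iP mP).ext (hY.congr (.of_forall fun p => ?_))
    by_cases h1 : p.1 ∈ B <;> simp [K', h1]
  have hYP : Y * P = Y := by
    refine (hY.mul_right iP).ext (hY.congr (.of_forall fun p => ?_))
    by_cases h1 : p.2 ∈ B <;> simp [K', h1]
  have hW : (Y - F) * Zb = Zb * (Y - F) := by
    have := hcomm.trans hFZ
    rw [sub_mul, mul_sub, ← sub_eq_zero]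
    rw [← sub_eq_zero] at this
    rw [← neg_eq_zero, ← this]
    abel
  have hPW : P * (Y - F) = Y - F := by rw [mul_sub, hPY, hPF]
  have hWP : (Y - F) * P = Y - F := by rw [sub_mul, hYP, hFP]
  have hzero : Y - F = 0 := eq_zero_of_commute hB hb hPW
    (fun c r hr => commute_proj_closedBall hB hPW hWP hZ hW c hr) hf hL hY rfl
  rw [← sub_eq_zero.1 hzero, ← hn]
  exact (hsNorm_le_of_isKernel hL hY).trans hle'

end Main

/-! ### Comparison of `L` and `L₁` -/

section Comparison

variable {Ω : Set ℂ}

/-- Supplies the admissible test functions for `L`: the normalised exponentials and, for bounded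
`Ω`, the coordinate function. -/
theorem lipNorm_toLp_le {φ : ℂ → ℂ} (hφ : MemLp φ ∞ (leb Ω))
    (h : ∀ s t, ‖φ s - φ t‖ ≤ ‖s - t‖) :
    hφ.toLp φ ∈ Lam Ω ∧ lipNorm (hφ.toLp φ) ≤ 1 := by
  have hfm : AEMeasurable (hφ.toLp φ) (leb Ω) := (Lp.memLp _).1.aemeasurable
  have hDm : AEStronglyMeasurable (diffQuot (hφ.toLp φ)) ((leb Ω).prod (leb Ω)) :=
    AEMeasurable.aestronglyMeasurable ((hfm.comp_fst.sub hfm.comp_snd).div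
      (measurable_fst.sub measurable_snd).aemeasurable)
  have hb : ∀ᵐ p ∂(leb Ω).prod (leb Ω), ‖diffQuot (hφ.toLp φ) p‖ ≤ 1 := by
    filter_upwards [ae_fst hφ.coeFn_toLp, ae_snd hφ.coeFn_toLp] with p h1 h2
    rw [diffQuot, h1, h2, norm_div]
    exact div_le_one_of_le₀ (h _ _) (norm_nonneg _)
  refine ⟨memLp_top_of_bound hDm 1 hb, ?_⟩
  rw [lipNorm, eLpNorm_exponent_top]
  simpa using eLpNormEssSup_le_of_ae_bound hb

theorem norm_exp_sub_exp_le (w s t : ℂ) :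
    ‖Complex.exp (Complex.I * ((s * conj w).re : ℂ)) -
      Complex.exp (Complex.I * ((t * conj w).re : ℂ))‖ ≤ ‖w‖ * ‖s - t‖ := by
  have e : Complex.exp (Complex.I * ((s * conj w).re : ℂ)) -
      Complex.exp (Complex.I * ((t * conj w).re : ℂ)) =
      Complex.exp (((t * conj w).re : ℂ) * Complex.I) *
        (Complex.exp (Complex.I * (((s - t) * conj w).re : ℝ)) - 1) := by
    rw [mul_sub, ← Complex.exp_add, mul_one, mul_comm _ Complex.I, ← mul_add, ← Complex.ofReal_add,
      sub_mul, Complex.sub_re, add_sub_cancel]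
  rw [e, norm_mul, Complex.norm_exp_ofReal_mul_I, one_mul]
  refine (Real.norm_exp_I_mul_ofReal_sub_one_le).trans ?_
  rw [Real.norm_eq_abs]
  refine (Complex.abs_re_le_norm _).trans ?_
  rw [norm_mul, RCLike.norm_conj, mul_comm]

theorem isMul_U (w : ℂ) :
    IsMul (U Ω w) (fun z => Complex.exp (Complex.I * ((z * conj w).re : ℂ))) :=
  isMul_toLp (memLp_e Ω w)

theorem enorm_inv_norm {w : ℂ} (hw : w ≠ 0) : ‖((‖w‖ : ℂ))⁻¹‖ₑ = ‖w‖ₑ⁻¹ := by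
  rw [enorm_inv (by simpa using hw)]
  simp [← ofReal_norm]

theorem inv_mul_hsNorm {w : ℂ} (hw : w ≠ 0) (X : Op Ω) :
    ‖w‖ₑ⁻¹ * hsNorm X = hsNorm (((‖w‖ : ℂ))⁻¹ • X) := by
  rw [hsNorm_smul, enorm_inv_norm hw]

theorem L₁_le_L (T : Op Ω) : L₁ T ≤ L T := by
  refine iSup₂_le fun w hw => ?_
  have hw0 : 0 < ‖w‖ := norm_pos_iff.2 hw
  have hm := (memLp_e Ω w).const_mul ((‖w‖ : ℂ))⁻¹
  have hl := lipNorm_toLp_le hm fun s t => by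
    rw [← mul_sub, norm_mul, norm_inv, Complex.norm_real, norm_norm, inv_mul_le_iff₀ hw0]
    exact norm_exp_sub_exp_le w s t
  have e : mulOp (hm.toLp _) = ((‖w‖ : ℂ))⁻¹ • U Ω w :=
    (isMul_toLp hm).ext ((isMul_U w).smul _) (.of_forall fun _ => rfl)
  refine le_trans (le_of_eq ?_) (le_L T hl.1 hl.2)
  rw [hsNorm_sub_comm (T * U Ω w), inv_mul_hsNorm hw, e, smul_mul_assoc, mul_smul_comm,
    ← smul_sub]

theorem le_L₁ (T : Op Ω) {w : ℂ} (hw : w ≠ 0) :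
    ‖w‖ₑ⁻¹ * hsNorm (T * U Ω w - U Ω w * T) ≤ L₁ T :=
  le_iSup₂_of_le w hw le_rfl

theorem hsNorm_proj_mul_mul_proj_le {S : Set ℂ} (hS : MeasurableSet S) (X : Op Ω) :
    hsNorm (proj Ω hS * X * proj Ω hS) ≤ hsNorm X := by
  have h : ‖proj Ω hS‖ₑ ≤ 1 := by
    rw [← ofReal_norm]
    refine ENNReal.ofReal_le_one.2 (ContinuousLinearMap.opNorm_le_bound _ zero_le_one fun x => ?_)
    rw [one_mul]
    exact norm_proj_apply_le hS x
  calc _ ≤ hsNorm (proj Ω hS * X) * ‖proj Ω hS‖ₑ := hsNorm_mul_le' _ _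
    _ ≤ (‖proj Ω hS‖ₑ * hsNorm X) * ‖proj Ω hS‖ₑ := by gcongr; exact hsNorm_mul_le _ _
    _ ≤ (1 * hsNorm X) * 1 := by gcongr
    _ = _ := by simp

theorem tendsto_slope_exp (a : ℝ) :
    Filter.Tendsto (fun n : ℕ => (Complex.I * ((1 / ((n : ℝ) + 1) : ℝ) : ℂ))⁻¹ *
      (Complex.exp (Complex.I * ((1 / ((n : ℝ) + 1) * a : ℝ) : ℂ)) - 1)) Filter.atTop
      (nhds (a : ℂ)) := by
  have h : HasDerivAt (fun t : ℂ => Complex.exp (t * a)) (a : ℂ) 0 := by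
    simpa using ((hasDerivAt_id (0 : ℂ)).mul_const (a : ℂ)).cexp
  have h2 := h.tendsto_slope_zero
  have h3 : Filter.Tendsto (fun n : ℕ => Complex.I * ((1 / ((n : ℝ) + 1) : ℝ) : ℂ)) Filter.atTop
      (nhdsWithin 0 {0}ᶜ) := by
    refine tendsto_nhdsWithin_iff.2 ⟨?_, .of_forall fun n => ?_⟩
    · have h0 := (Complex.continuous_ofReal.tendsto 0).comp
        (tendsto_one_div_add_atTop_nhds_zero_nat (𝕜 := ℝ))
      simpa using h0.const_mul Complex.I
    · have := (Nat.one_div_pos_of_nat (α := ℝ) (n := n)).ne'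
      simp only [Set.mem_compl_iff, Set.mem_singleton_iff, mul_eq_zero, Complex.I_ne_zero,
        Complex.ofReal_eq_zero, false_or]
      exact this
  refine (h2.comp h3).congr fun n => ?_
  simp only [Function.comp_apply, zero_add, zero_mul, Complex.exp_zero, smul_eq_mul,
    Complex.ofReal_mul, mul_assoc]

/-- The commutator with a real linear function is dominated by `L₁`, on bounded sets. -/
theorem hsNorm_commutator_re_le (T : Op Ω) {B : Set ℂ} (hB : MeasurableSet B) {C : ℝ}
    (hC : ∀ z ∈ B, ‖z‖ ≤ C) {w : ℂ} (hw : ‖w‖ = 1) {A : Op Ω}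
    (hA : IsMul A (B.indicator fun z => ((z * conj w).re : ℂ))) :
    hsNorm (A * (proj Ω hB * T * proj Ω hB) - proj Ω hB * T * proj Ω hB * A) ≤ L₁ T := by
  set P := proj Ω hB
  have iP : IsMul P (B.indicator 1) := isMul_proj hB
  have hPP : P * P = P := proj_mul_self hB
  let t : ℕ → ℝ := fun n => 1 / ((n : ℝ) + 1)
  have ht (n) : 0 < t n := Nat.one_div_pos_of_nat
  -- Truncated difference quotients `(U(tw) - 1) / (it)` at `t = 1 / (n + 1)`, converging strongly
  -- to `A`. As `‖w‖ = 1`, the factor `1 / t` is exactly the weight `1 / ‖tw‖` in `L₁`.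
  let M : ℕ → Op Ω := fun n =>
    (Complex.I * (t n : ℂ))⁻¹ • (P * (U Ω (t n * w) - 1))
  have iM (n) : IsMul (M n) (fun z => (Complex.I * (t n : ℂ))⁻¹ * (B.indicator 1 z *
      (Complex.exp (Complex.I * ((z * conj (t n * w)).re : ℂ)) - 1))) :=
    (iP.mul ((isMul_U _).sub isMul_one)).smul _
  have hre (n : ℕ) (z : ℂ) : (z * conj ((t n : ℂ) * w)).re = t n * (z * conj w).re := by
    rw [map_mul, Complex.conj_ofReal, mul_left_comm, Complex.re_ofReal_mul]
  have hMA (x : L2 Ω) : Filter.Tendsto (fun n => M n x) Filter.atTop (nhds (A x)) := by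
    refine IsMul.tendsto iM hA (C := |C| + |C|) (fun n => .of_forall fun z => ?_)
      (.of_forall fun z => ?_) x
    · by_cases hz : z ∈ B
      · rw [Set.indicator_of_mem hz, Set.indicator_of_mem hz, Pi.one_apply, one_mul]
        have hzw : |(z * conj w).re| ≤ |C| := by
          refine (Complex.abs_re_le_norm _).trans ?_
          rw [norm_mul, RCLike.norm_conj, hw, mul_one]
          exact (hC z hz).trans (le_abs_self C)
        refine (norm_sub_le _ _).trans (add_le_add ?_ ?_)
        · rw [norm_mul, norm_inv, norm_mul, Complex.norm_I, one_mul, Complex.norm_real,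
            Real.norm_of_nonneg (ht n).le, inv_mul_le_iff₀ (ht n), hre]
          refine (Real.norm_exp_I_mul_ofReal_sub_one_le).trans ?_
          rw [norm_mul, Real.norm_of_nonneg (ht n).le, Real.norm_eq_abs]
          exact mul_le_mul_of_nonneg_left hzw (ht n).le
        · rw [Complex.norm_real, Real.norm_eq_abs]; exact hzw
      · rw [Set.indicator_of_notMem hz, Set.indicator_of_notMem hz]
        rw [zero_mul, mul_zero, sub_zero, norm_zero]
        positivity
    · by_cases hz : z ∈ B
      · simp only [Set.indicator_of_mem hz, Pi.one_apply, one_mul, hre]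
        exact tendsto_slope_exp _
      · simp only [Set.indicator_of_notMem hz, zero_mul, mul_zero]
        exact tendsto_const_nhds
  refine hsNorm_le_of_tendsto (l := Filter.atTop)
    (A := fun n => M n * (P * T * P) - P * T * P * M n) (fun x => ?_) (.of_forall fun n => ?_)
  · exact (hMA _).sub (((P * T * P).continuous.tendsto _).comp (hMA x))
  · have hUP : U Ω (t n * w) * P = P * U Ω (t n * w) := (isMul_U _).comm iP
    have htw : (t n : ℂ) * w ≠ 0 := by
      refine mul_ne_zero (by exact_mod_cast (ht n).ne') (norm_pos_iff.1 (by rw [hw]; exact one_pos))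
    -- The identity drops out of the commutator and `P` commutes with `U`, leaving a compression of
    -- `[U(tw), T]`.
    have e : M n * (P * T * P) - P * T * P * M n = (Complex.I * (t n : ℂ))⁻¹ •
        (P * (U Ω (t n * w) * T - T * U Ω (t n * w)) * P) := by
      simp only [M]
      rw [smul_mul_assoc, mul_smul_comm, ← smul_sub]
      congr 1
      calc P * (U Ω (t n * w) - 1) * (P * T * P) - P * T * P * (P * (U Ω (t n * w) - 1))
          = P * (U Ω (t n * w) * P) * T * P - (P * P) * T * P - P * T * ((P * P) * U Ω (t n * w))
            + P * T * (P * P) := by noncomm_ring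
        _ = (P * P) * (U Ω (t n * w) * T) * P - P * T * (U Ω (t n * w) * P) := by
            rw [hUP, ← mul_assoc P P, hPP]; noncomm_ring
        _ = _ := by rw [hPP]; noncomm_ring
    have en : ‖(Complex.I * (t n : ℂ))⁻¹‖ₑ = ‖(t n : ℂ) * w‖ₑ⁻¹ := by
      rw [enorm_inv (mul_ne_zero Complex.I_ne_zero (by exact_mod_cast (ht n).ne')),
        ← ofReal_norm, ← ofReal_norm, norm_mul, norm_mul, hw, Complex.norm_I, one_mul, mul_one]
    rw [e, hsNorm_smul, en]
    refine le_trans ?_ (le_L₁ T htw)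
    gcongr
    refine (hsNorm_proj_mul_mul_proj_le hB _).trans (le_of_eq (hsNorm_sub_comm _ _))

/-- The compressions of `T` to the discs of radius `n` converge strongly to `T`, so a bound uniform
in `n` passes to the limit, even for unbounded `Ω`. -/
theorem hsNorm_commutator_le_two_mul_L₁ (T : Op Ω) {f : LInf Ω} (hf : lipNorm f ≤ 1) :
    hsNorm (mulOp f * T - T * mulOp f) ≤ 2 * L₁ T := by
  have hm (n : ℕ) : MeasurableSet (Metric.closedBall (0 : ℂ) n) :=
    Metric.isClosed_closedBall.measurableSet
  have hP (x : L2 Ω) :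
      Filter.Tendsto (fun n => proj Ω (hm n) x) Filter.atTop (nhds x) := by
    refine IsMul.tendsto (fun n => isMul_proj (hm n)) isMul_one (C := 1 + 1)
      (fun n => .of_forall fun z => (norm_sub_le _ _).trans (add_le_add
        (norm_indicator_le (φ := 1) zero_le_one (by simp) z) (by simp)))
      (.of_forall fun z => ?_) x
    refine tendsto_const_nhds.congr' ?_
    obtain ⟨N, hN⟩ := exists_nat_ge ‖z‖
    filter_upwards [Filter.eventually_ge_atTop N] with n hn
    rw [Set.indicator_of_mem]
    simpa using hN.trans (by exact_mod_cast hn)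
  have hT (x : L2 Ω) : Filter.Tendsto (fun n => (proj Ω (hm n) * T * proj Ω (hm n)) x)
      Filter.atTop (nhds (T x)) := by
    have h1 : Filter.Tendsto (fun n => T (proj Ω (hm n) x)) Filter.atTop (nhds (T x)) :=
      (T.continuous.tendsto _).comp (hP x)
    rw [tendsto_iff_norm_sub_tendsto_zero]
    have h2 := (tendsto_iff_norm_sub_tendsto_zero.1 h1).add
      (tendsto_iff_norm_sub_tendsto_zero.1 (hP (T x)))
    rw [add_zero] at h2
    refine squeeze_zero (fun n => norm_nonneg _) (fun n => ?_) h2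
    have : (proj Ω (hm n) * T * proj Ω (hm n)) x - T x =
        proj Ω (hm n) (T (proj Ω (hm n) x) - T x) + (proj Ω (hm n) (T x) - T x) := by
      rw [map_sub]; simp only [mul_apply_eq_comp]; abel
    rw [this]
    exact (norm_add_le _ _).trans (by gcongr; exact norm_proj_apply_le _ _)
  refine hsNorm_le_of_tendsto (l := Filter.atTop)
    (A := fun n => mulOp f * (proj Ω (hm n) * T * proj Ω (hm n))
      - proj Ω (hm n) * T * proj Ω (hm n) * mulOp f) (fun x => ?_) (.of_forall fun n => ?_)
  · exact (((mulOp f).continuous.tendsto _).comp (hT x)).sub (hT (mulOp f x))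
  · set P := proj Ω (hm n)
    have hPP : P * P = P := proj_mul_self (hm n)
    have hC : ∀ z ∈ Metric.closedBall (0 : ℂ) n, ‖z‖ ≤ n := fun z hz => by simpa using hz
    have mA {w : ℂ} (hw : ‖w‖ = 1) : MemLp ((Metric.closedBall (0 : ℂ) n).indicator
        fun z => ((z * conj w).re : ℂ)) ∞ (leb Ω) := by
      refine memLp_indicator (hm n) (by fun_prop) n.cast_nonneg fun z hz => ?_
      rw [Complex.norm_real, Real.norm_eq_abs]
      refine (Complex.abs_re_le_norm _).trans ?_
      rw [norm_mul, RCLike.norm_conj, hw, mul_one]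
      exact hC z hz
    have i1 := isMul_toLp (mA (w := 1) (by simp))
    have i2 := isMul_toLp (mA (w := Complex.I) (by simp))
    have b1 := hsNorm_commutator_re_le T (hm n) hC (by simp) i1
    have b2 := hsNorm_commutator_re_le T (hm n) hC (by simp) i2
    set A₁ := mulOp ((mA (w := 1) (by simp)).toLp _)
    set A₂ := mulOp ((mA (w := Complex.I) (by simp)).toLp _)
    -- The directions `w = 1` and `w = i` give `Re z` and `Im z`. Each commutator costs one `L₁ T`,
    -- hence the factor 2.
    have iZ : IsMul (A₁ + Complex.I • A₂) ((Metric.closedBall (0 : ℂ) n).indicator id) := by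
      refine (i1.add (i2.smul Complex.I)).congr (.of_forall fun z => ?_)
      simp only
      by_cases hz : z ∈ Metric.closedBall (0 : ℂ) n
      · simp only [Set.indicator_of_mem hz]
        apply Complex.ext <;> simp
      · simp only [Set.indicator_of_notMem hz]; simp
    refine (hsNorm_commutator_le (hm n) Metric.isBounded_closedBall
      (T := P * T * P) (by rw [← mul_assoc, ← mul_assoc, hPP])
      (by rw [mul_assoc, hPP]) iZ hf).trans ?_
    have e : (A₁ + Complex.I • A₂) * (P * T * P) - P * T * P * (A₁ + Complex.I • A₂) =
        (A₁ * (P * T * P) - P * T * P * A₁) +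
          Complex.I • (A₂ * (P * T * P) - P * T * P * A₂) := by
      simp only [add_mul, mul_add, smul_mul_assoc, mul_smul_comm, smul_sub]
      abel
    rw [e, two_mul]
    refine (hsNorm_triangle _ _).trans (add_le_add b1 ?_)
    rw [hsNorm_smul]
    simpa [← ofReal_norm] using b2

theorem L_le_two_mul_L₁ (T : Op Ω) : L T ≤ 2 * L₁ T :=
  iSup₂_le fun _ _ => iSup_le fun hf => hsNorm_commutator_le_two_mul_L₁ T hf

/-- Upper bound: the main inequality with `B = Ω`, whose projection is the identity. Lower bound:
the coordinate function is bounded and 1-Lipschitz, hence competes in the supremum. -/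
theorem L_eq_hsNorm_commutator_Z (hΩ : MeasurableSet Ω) (hb : Bornology.IsBounded Ω) (T : Op Ω) :
    L T = hsNorm (T * Z hΩ hb - Z hΩ hb * T) := by
  rw [hsNorm_sub_comm]
  have hP : proj Ω hΩ = 1 := (isMul_proj hΩ).ext isMul_one (by
    filter_upwards [ae_restrict_mem hΩ] with z hz
    rw [Set.indicator_of_mem hz])
  have hZ : IsMul (Z hΩ hb) (Ω.indicator id) := (isMul_toLp (memLp_id hΩ hb)).congr (by
    filter_upwards [ae_restrict_mem hΩ] with z hz
    rw [Set.indicator_of_mem hz, id])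
  refine le_antisymm (iSup₂_le fun f _ => iSup_le fun hf => ?_) ?_
  · exact hsNorm_commutator_le hΩ hb (by rw [hP, one_mul]) (by rw [hP, mul_one]) hZ hf
  · have h := lipNorm_toLp_le (memLp_id hΩ hb) fun _ _ => le_rfl
    exact le_L T h.1 h.2

end Comparison

/-! ### The norm `|||·|||₁` -/

section Norm

variable {Ω : Set ℂ}

theorem L₁_add_le (S T : Op Ω) : L₁ (S + T) ≤ L₁ S + L₁ T := by
  refine iSup₂_le fun w hw => ?_
  have e : (S + T) * U Ω w - U Ω w * (S + T)
      = (S * U Ω w - U Ω w * S) + (T * U Ω w - U Ω w * T) := by noncomm_ring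
  rw [e]
  calc _ ≤ ‖w‖ₑ⁻¹ * (hsNorm (S * U Ω w - U Ω w * S) + hsNorm (T * U Ω w - U Ω w * T)) := by
        gcongr; exact hsNorm_triangle _ _
    _ = ‖w‖ₑ⁻¹ * hsNorm (S * U Ω w - U Ω w * S) + ‖w‖ₑ⁻¹ * hsNorm (T * U Ω w - U Ω w * T) :=
        mul_add _ _ _
    _ ≤ _ := add_le_add (le_L₁ S hw) (le_L₁ T hw)

theorem L₁_smul (c : ℂ) (T : Op Ω) : L₁ (c • T) = ‖c‖ₑ * L₁ T := by
  simp only [L₁, ENNReal.mul_iSup]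
  refine iSup_congr fun w => iSup_congr fun _ => ?_
  rw [smul_mul_assoc, mul_smul_comm, ← smul_sub, hsNorm_smul, mul_left_comm]

theorem L₁_neg (T : Op Ω) : L₁ (-T) = L₁ T := by
  rw [← neg_one_smul ℂ T, L₁_smul]
  simp

theorem L₁_mul_le (S T : Op Ω) : L₁ (S * T) ≤ L₁ S * ‖T‖ₑ + ‖S‖ₑ * L₁ T := by
  refine iSup₂_le fun w hw => ?_
  have e : (S * T) * U Ω w - U Ω w * (S * T)
      = (S * U Ω w - U Ω w * S) * T + S * (T * U Ω w - U Ω w * T) := by noncomm_ring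
  rw [e]
  calc _ ≤ ‖w‖ₑ⁻¹ * (hsNorm (S * U Ω w - U Ω w * S) * ‖T‖ₑ +
          ‖S‖ₑ * hsNorm (T * U Ω w - U Ω w * T)) := by
        gcongr
        exact (hsNorm_triangle _ _).trans (add_le_add (hsNorm_mul_le' _ _) (hsNorm_mul_le _ _))
    _ = (‖w‖ₑ⁻¹ * hsNorm (S * U Ω w - U Ω w * S)) * ‖T‖ₑ +
          ‖S‖ₑ * (‖w‖ₑ⁻¹ * hsNorm (T * U Ω w - U Ω w * T)) := by ring
    _ ≤ _ := by gcongr <;> exact le_L₁ _ hw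

/-- `L₁` is lower semicontinuous. -/
theorem L₁_le_of_tendsto {ι : Type*} {l : Filter ι} [l.NeBot] {A : ι → Op Ω} {B : Op Ω}
    {C : ℝ≥0∞} (h : Filter.Tendsto A l (nhds B)) (hC : ∀ᶠ n in l, L₁ (A n) ≤ C) : L₁ B ≤ C := by
  refine iSup₂_le fun w hw => ?_
  rw [inv_mul_hsNorm hw]
  have hx (x : L2 Ω) : Filter.Tendsto (fun n => A n x) l (nhds (B x)) :=
    ((ContinuousLinearMap.apply ℂ (L2 Ω) x).continuous.tendsto B).comp h
  refine hsNorm_le_of_tendsto (l := l)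
    (A := fun n => ((‖w‖ : ℂ))⁻¹ • (A n * U Ω w - U Ω w * A n)) (fun x => ?_) ?_
  · have h1 := (hx (U Ω w x)).sub (((U Ω w).continuous.tendsto _).comp (hx x))
    exact h1.const_smul ((‖w‖ : ℂ))⁻¹
  filter_upwards [hC] with n hn
  rw [← inv_mul_hsNorm hw]
  exact (le_L₁ _ hw).trans hn

theorem L₁_ne_top (T : EΛ Ω) : L₁ (T : Op Ω) ≠ ∞ := ((L₁_le_L _).trans_lt T.2).ne

theorem triNorm₁_neg (T : EΛ Ω) : triNorm₁ (-T) = triNorm₁ T := by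
  simp [triNorm₁, L₁_neg]

theorem norm_le_triNorm₁ (T : EΛ Ω) : ‖(T : Op Ω)‖ ≤ triNorm₁ T :=
  le_add_of_nonneg_right ENNReal.toReal_nonneg

theorem L₁_le_ofReal_triNorm₁ (T : EΛ Ω) : L₁ (T : Op Ω) ≤ ENNReal.ofReal (triNorm₁ T) := by
  rw [← ENNReal.ofReal_toReal (L₁_ne_top T)]
  exact ENNReal.ofReal_le_ofReal (le_add_of_nonneg_left (norm_nonneg _))

variable (Ω) in
/-- The norm `|||·|||₁` as a norm of algebras. -/
def algebraNorm₁ : AlgebraNorm ℂ (EΛ Ω) where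
  toFun := triNorm₁
  map_zero' := by
    have : L₁ (0 : Op Ω) = 0 := by simpa using L₁_smul 0 (0 : Op Ω)
    simp [triNorm₁, this]
  add_le' S T := by
    have h := ENNReal.toReal_mono (ENNReal.add_ne_top.2 ⟨L₁_ne_top S, L₁_ne_top T⟩)
      (L₁_add_le (S : Op Ω) T)
    rw [ENNReal.toReal_add (L₁_ne_top S) (L₁_ne_top T)] at h
    have h2 := norm_add_le (S : Op Ω) T
    simp only [triNorm₁, Subalgebra.coe_add]
    linarith
  neg' := triNorm₁_neg
  mul_le' S T := by
    have h := ENNReal.toReal_mono (ENNReal.add_ne_top.2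
      ⟨ENNReal.mul_ne_top (L₁_ne_top S) enorm_ne_top,
        ENNReal.mul_ne_top enorm_ne_top (L₁_ne_top T)⟩) (L₁_mul_le (S : Op Ω) T)
    rw [ENNReal.toReal_add (ENNReal.mul_ne_top (L₁_ne_top S) enorm_ne_top)
      (ENNReal.mul_ne_top enorm_ne_top (L₁_ne_top T)), ENNReal.toReal_mul, ENNReal.toReal_mul,
      toReal_enorm, toReal_enorm] at h
    have h2 := norm_mul_le (S : Op Ω) T
    -- The one term of the expanded product of norms that the Leibniz bound does not use.
    have h3 : 0 ≤ (L₁ (S : Op Ω)).toReal * (L₁ (T : Op Ω)).toReal := by positivity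
    simp only [triNorm₁, Subalgebra.coe_mul]
    linarith
  smul' c T := by
    simp only [triNorm₁, Subalgebra.coe_smul, L₁_smul, norm_smul, ENNReal.toReal_mul, toReal_enorm]
    ring
  eq_zero_of_map_eq_zero' T h := by
    have h2 := norm_le_triNorm₁ T
    have h3 : triNorm₁ T = 0 := h
    rw [h3, norm_le_zero_iff] at h2
    exact Subtype.ext h2

/-- A Cauchy sequence has a limit in operator norm; lower semicontinuity of `L₁` carries the Cauchy
estimates over to that limit. -/
theorem exists_triNorm₁_limit (u : ℕ → EΛ Ω)
    (hu : ∀ ε > 0, ∃ N, ∀ m ≥ N, ∀ n ≥ N, triNorm₁ (u m - u n) < ε) :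
    ∃ T : EΛ Ω, ∀ ε > 0, ∃ N, ∀ n ≥ N, triNorm₁ (u n - T) < ε := by
  have hc : CauchySeq (fun n => (u n : Op Ω)) := by
    refine Metric.cauchySeq_iff.2 fun ε hε => ?_
    obtain ⟨N, hN⟩ := hu ε hε
    refine ⟨N, fun m hm n hn => ?_⟩
    rw [dist_eq_norm]
    exact (norm_le_triNorm₁ (u m - u n)).trans_lt (hN m hm n hn)
  obtain ⟨T, hT⟩ := cauchySeq_tendsto_of_complete hc
  have key {ε : ℝ} {N : ℕ} (hN : ∀ m ≥ N, ∀ n ≥ N, triNorm₁ (u m - u n) < ε) {n : ℕ}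
      (hn : N ≤ n) : L₁ ((u n : Op Ω) - T) ≤ ENNReal.ofReal ε := by
    refine L₁_le_of_tendsto (l := Filter.atTop) (A := fun m => (u n : Op Ω) - (u m : Op Ω))
      (hT.const_sub _) ?_
    filter_upwards [Filter.eventually_ge_atTop N] with m hm
    exact (L₁_le_ofReal_triNorm₁ (u n - u m)).trans
      (ENNReal.ofReal_le_ofReal (hN n hn m hm).le)
  have hTmem : T ∈ EΛ Ω := by
    obtain ⟨N, hN⟩ := hu 1 one_pos
    have h1 : L₁ T ≤ L₁ (u N : Op Ω) + ENNReal.ofReal 1 := by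
      have e : T = u N + -((u N : Op Ω) - T) := by abel
      calc L₁ T = L₁ ((u N : Op Ω) + -((u N : Op Ω) - T)) := by rw [← e]
        _ ≤ _ := (L₁_add_le _ _).trans (by rw [L₁_neg]; gcongr; exact key hN le_rfl)
    -- Membership is defined by `L`, so the finiteness of `L₁ T` must be converted through `L ≤ 2
    -- L₁`.
    exact (L_le_two_mul_L₁ T).trans_lt (ENNReal.mul_lt_top ENNReal.ofNat_lt_top
      (h1.trans_lt (ENNReal.add_lt_top.2 ⟨(L₁_ne_top _).lt_top, ENNReal.ofReal_lt_top⟩)))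
  refine ⟨⟨T, hTmem⟩, fun ε hε => ?_⟩
  obtain ⟨N₁, hN₁⟩ := hu (ε / 2) (by positivity)
  obtain ⟨N₂, hN₂⟩ := Metric.tendsto_atTop.1 hT (ε / 2) (by positivity)
  refine ⟨max N₁ N₂, fun n hn => ?_⟩
  have h1 := ENNReal.toReal_mono ENNReal.ofReal_ne_top (key hN₁ ((le_max_left _ _).trans hn))
  rw [ENNReal.toReal_ofReal (by positivity)] at h1
  have h2 := hN₂ n ((le_max_right _ _).trans hn)
  rw [dist_eq_norm] at h2
  simp only [triNorm₁, Subalgebra.coe_sub]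
  linarith

theorem _root_.RingNorm.completeSpace {A : Type*} [Ring A] (p : RingNorm A)
    (h : ∀ u : ℕ → A, (∀ ε > 0, ∃ N, ∀ m ≥ N, ∀ n ≥ N, p (u m - u n) < ε) →
      ∃ x, ∀ ε > 0, ∃ N, ∀ n ≥ N, p (u n - x) < ε) :
    @CompleteSpace A p.toNormedRing.toMetricSpace.toUniformSpace := by
  let _ : NormedRing A := p.toNormedRing
  refine Metric.complete_of_cauchySeq_tendsto fun u hu => ?_
  have hd (x y : A) : dist x y = p (x - y) := dist_eq_norm x y
  obtain ⟨x, hx⟩ := h u fun ε hε => by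
    obtain ⟨N, hN⟩ := Metric.cauchySeq_iff.1 hu ε hε
    exact ⟨N, fun m hm n hn => (hd _ _).symm.trans_lt (hN m hm n hn)⟩
  refine ⟨x, Metric.tendsto_atTop.2 fun ε hε => ?_⟩
  obtain ⟨N, hN⟩ := hx ε hε
  exact ⟨N, fun n hn => (hd _ _).trans_lt (hN n hn)⟩

theorem isBanachAlgebraNorm_triNorm₁ : IsBanachAlgebraNorm (triNorm₁ (Ω := Ω)) :=
  ⟨algebraNorm₁ Ω, fun _ => rfl,
    (algebraNorm₁ Ω).toRingNorm.completeSpace fun u hu => exists_triNorm₁_limit u hu⟩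

theorem normEquivalent_triNorm : NormEquivalent (triNorm (Ω := Ω)) (triNorm₁ (Ω := Ω)) := by
  -- The constants come from `L ≤ 2 L₁` and `L₁ ≤ L`.
  refine ⟨1 / 2, 1, by norm_num, one_pos, fun T => ?_⟩
  have h1 := ENNReal.toReal_mono T.2.ne (L₁_le_L (T : Op Ω))
  have h2 := ENNReal.toReal_mono (ENNReal.mul_ne_top ENNReal.ofNat_ne_top (L₁_ne_top T))
    (L_le_two_mul_L₁ (T : Op Ω))
  rw [ENNReal.toReal_mul, ENNReal.toReal_ofNat] at h2
  have h3 := norm_nonneg (T : Op Ω)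
  simp only [triNorm, triNorm₁]
  constructor <;> linarith

end Norm

end

end ELam

theorem mainTheorem10 (Ω : Set ℂ) (hΩ : MeasurableSet Ω) :
    (∀ T : ELam.Op Ω, ELam.L₁ T ≤ ELam.L T ∧ ELam.L T ≤ 2 * ELam.L₁ T) ∧
    ELam.IsBanachAlgebraNorm (ELam.triNorm₁ (Ω := Ω)) ∧
    ELam.NormEquivalent (ELam.triNorm (Ω := Ω)) (ELam.triNorm₁ (Ω := Ω)) ∧
    (∀ (hb : Bornology.IsBounded Ω) (T : ELam.Op Ω),
      ELam.L T = ELam.hsNorm (T * ELam.Z hΩ hb - ELam.Z hΩ hb * T)) :=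
  ⟨fun T => ⟨ELam.L₁_le_L T, ELam.L_le_two_mul_L₁ T⟩, ELam.isBanachAlgebraNorm_triNorm₁,
    ELam.normEquivalent_triNorm, fun hb T => ELam.L_eq_hsNorm_commutator_Z hΩ hb T⟩
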